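/- Notation. $[A]^{<\omega}$ and $[A]^{\le\omega}$ are the families of finite, respectively countable, subsets of $A$. A family $\mathcal U$ of sets is an $\omega$-cover of $Y$ if every finite $K\subseteq Y$ is contained in some $U\in\mathcal U$. A topological space is an $(\varepsilon)$-space if each of its open $\omega$-covers has a countable subfamily that is an $\omega$-cover; it is hereditarily $(\varepsilon)$ (hereditarily Lindelöf) if every subspace is an $(\varepsilon)$-space (every open cover of every subspace has a countable subcover; no separation is assumed). A family $\mathcal N$ of subsets of a space is a local $\pi$-network at $x$ if every open neighbourhood of $x$ contains a member of $\mathcal N$. Let $\mathcal W$ be the countable family of the sets $Q^*=\{H\in[\mathbb R]^{<\omega}:H\subseteq Q\}$, where $Q$ is a disjoint union of finitely many open intervals with rational endpoints. $H(\vartheta)$ is the set of all sets whose transitive closure has size $<\vartheta$; "sufficiently large $\vartheta$" means: $\vartheta$ regular and $\vartheta>2^{2^{\omega}}$. The construction. Let $\{C_\alpha\}_{\alpha<\omega_1}=[\omega_1]^{\le\omega}$ be an enumeration with $C_\alpha\subseteq\alpha$ for all $\alpha$, and let $\{B_\gamma\}_{\gamma<\omega_1}$ be a $\diamondsuit$-sequence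 on $[\omega_1]^{<\omega}$: for every uncountable $B\subseteq[\omega_1]^{<\omega}$ the set of $\beta<\omega_1$ with $B\cap[\beta]^{<\omega}=B_\beta$ is stationary. Call $\{U^\alpha_\gamma\}_{\gamma\le\alpha<\omega_1}$ together with $\varphi_\alpha:\alpha+1\to[\mathbb R]^{<\omega}$ ($\alpha<\omega_1$) a *construction for $\{C_\alpha\}$, $\{B_\gamma\}$* if, for all $\alpha<\omega_1$: (1) $U^\alpha_\gamma\subseteq\alpha+1$ for $\gamma\le\alpha$, $U^\alpha_\alpha=\alpha+1$, and the sets $\varphi_\alpha(\xi)$, $\xi\le\alpha$, are pairwise disjoint. (2) $U^\alpha_\gamma=U^{\alpha_0}_\gamma\cap(\alpha+1)$ and $\varphi_\alpha=\varphi_{\alpha_0}\restriction(\alpha+1)$ whenever $\gamma\le\alpha\le\alpha_0<\omega_1$. Let $\tau_\alpha$ be the topology on $\alpha+1$ with subbase $\{U^\alpha_\gamma:\gamma\le\alpha\}\cup\{\varphi_\alpha^{-1}(W):W\in\mathcal W\}$, and let $U^\alpha_F=\bigcap_{\gamma\in F}U^\alpha_\gamma$ for finite $F\subseteq\alpha+1$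 (with $U^\alpha_\emptyset=\alpha+1$). (3) If $C_\alpha$ is closed discrete in $\tau_\alpha$, then $\bigcup\{U^\alpha_\gamma:\gamma\in C_\alpha\}\ne\alpha+1$. (4) Let $T_\alpha$ be the set of those $\beta\le\alpha$ such that $B_\beta$ is a pairwise disjoint family of finite subsets of $\beta$ and, for some sufficiently large $\vartheta$, there is a countable elementary submodel $M\prec H(\vartheta)$ such that $M\cap\omega_1=\beta$; $\mathcal W,\{B_\gamma\}_{\gamma<\omega_1}\in M$; some function $f:\omega_1\to[\mathbb R]^{<\omega}$ in $M$ satisfies $f\restriction\beta=\varphi_\beta\restriction\beta$; some uncountable $B\subseteq[\omega_1]^{<\omega}$ in $M$ satisfies $M\cap B=B_\beta$; and some sequence $\{V_\gamma\}_{\gamma<\omega_1}$ of subsets of $\omega_1$ in $M$ satisfies $V_\gamma\cap\beta=U^\beta_\gamma\cap\beta$ for all $\gamma<\beta$. Then (a) if $\beta\in T_\alpha$, then $B_\beta$ is a local $\pi$-network at $\beta$ in $\tau_\alpha$; (b) if $\beta\in T_\alpha\cap\alpha$ and $\beta\in V\in\tau_\alpha$, then $\{U^\alpha_F:F\in B_\beta,\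 F\subseteq V\}$ is an $\omega$-cover of $(\beta,\alpha]$. Given a construction, put $U_\gamma=\bigcup\{U^\alpha_\gamma:\gamma\le\alpha<\omega_1\}$, $U_F=\bigcap_{\gamma\in F}U_\gamma$ for $F\in[\omega_1]^{<\omega}$ (with $U_\emptyset=\omega_1$), $\varphi=\bigcup_{\alpha<\omega_1}\varphi_\alpha$, and let $\tau$ be the topology on $\omega_1$ with subbase $\{U_\gamma:\gamma<\omega_1\}\cup\{\varphi^{-1}(W):W\in\mathcal W\}$. The space $(\omega_1,\tau)$ is the constructed space. Theorem. Assume $\diamondsuit$. Then enumerations $\{C_\alpha\}$ and $\diamondsuit$-sequences $\{B_\gamma\}$ as above exist, and for any such $\{C_\alpha\}$, $\{B_\gamma\}$ there is a construction, even one in which all the sets $\varphi_\alpha(\xi)$ are non-empty. Moreover, every construction for such $\{C_\alpha\}$, $\{B_\gamma\}$ has the following properties. (i) For every uncountable family $B\subseteq[\omega_1]^{<\omega}$ of pairwise disjoint sets there is a countable $B'\subseteq B$ such that $\{U_F:F\in B'\}$ covers $\omega_1$ and is an $\omega$-cover of a tail $\{\xi<\omega_1:\xi>\beta\}$ of $\omega_1$,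 for some $\beta<\omega_1$. (ii) The space $(\omega_1,\tau)$ is hereditarily Lindelöf. (iii) The space $(\omega_1,\tau)$ is hereditarily $(\varepsilon)$. -/

import Mathlib

open Set
open scoped Cardinal Topology

noncomputable section

/-! ### The index set `ω₁`, and `♢` -/

/-- The set `ω₁` of countable ordinals. -/
abbrev OmegaOne : Type := (Ordinal.omega 1 : Ordinal.{0}).ToType

/-- Jensen's principle `♢`. -/
def Diamond : Prop :=
  ∃ A : OmegaOne → Set OmegaOne,
    (∀ α, A α ⊆ Iio α) ∧ ∀ X : Set OmegaOne, IsStationary {α | X ∩ Iio α = A α}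

/-- `{C_α}` enumerates `[ω₁]^{≤ω}` and `C_α ⊆ α` for all `α`. -/
def IsCountableSetEnumeration (C : OmegaOne → Set OmegaOne) : Prop :=
  (∀ α, C α ⊆ Iio α) ∧ ∀ X : Set OmegaOne, X.Countable ↔ ∃ α, C α = X

/-- `{B_γ}` is a `♢`-sequence on `[ω₁]^{<ω}`. -/
def IsFinsetDiamondSequence (B : OmegaOne → Set (Finset OmegaOne)) : Prop :=
  ∀ S : Set (Finset OmegaOne), ¬ S.Countable →
    IsStationary {β | {F | F ∈ S ∧ (F : Set OmegaOne) ⊆ Iio β} = B β}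

/-! ### Topological notions -/

/-- `𝒰` is an `ω`-cover of `Y`: every finite subset of `Y` lies in a member of `𝒰`. -/
def IsOmegaCover {X : Type*} (𝒰 : Set (Set X)) (Y : Set X) : Prop :=
  ∀ K : Set X, K.Finite → K ⊆ Y → ∃ U ∈ 𝒰, K ⊆ U

/-- `(ε)`-spaces: every open `ω`-cover has a countable `ω`-subcover. -/
def IsEpsilonSpace (X : Type*) [TopologicalSpace X] : Prop :=
  ∀ 𝒰 : Set (Set X), (∀ U ∈ 𝒰, IsOpen U) → IsOmegaCover 𝒰 univ →
    ∃ 𝒱 ⊆ 𝒰, 𝒱.Countable ∧ IsOmegaCover 𝒱 univ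

/-- Every subspace is an `(ε)`-space. -/
def IsHereditarilyEpsilonSpace (X : Type*) [TopologicalSpace X] : Prop :=
  ∀ Y : Set X, IsEpsilonSpace Y

/-- `𝒩` is a local `π`-network at `x`. -/
def IsLocalPiNetwork {X : Type*} [TopologicalSpace X] (𝒩 : Set (Set X)) (x : X) : Prop :=
  ∀ U : Set X, IsOpen U → x ∈ U → ∃ N ∈ 𝒩, N ⊆ U

/-- `D` is closed and discrete in its subspace topology. -/
def IsClosedDiscrete {X : Type*} [TopologicalSpace X] (D : Set X) : Prop :=
  IsClosed D ∧ IsDiscrete D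

/-- The countable base `𝒲` for the topology on `[ℝ]^{<ω}`: all sets `Q^* = {H : H ⊆ Q}`, where `Q`
is a disjoint union of finitely many open intervals with rational endpoints. -/
def ratBase : Set (Set (Finset ℝ)) :=
  {W | ∃ I : Finset (ℚ × ℚ),
    (I : Set (ℚ × ℚ)).PairwiseDisjoint (fun p => Ioo (p.1 : ℝ) (p.2 : ℝ)) ∧
    W = {H : Finset ℝ | (H : Set ℝ) ⊆ ⋃ p ∈ I, Ioo (p.1 : ℝ) (p.2 : ℝ)}}

/-! ### The sets `H(θ)` and their elementary submodels -/

/-- The transitive closure of a set. -/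
def transitiveClosure (x : ZFSet.{0}) : Set ZFSet.{0} :=
  {y | Relation.TransGen (fun a b : ZFSet.{0} => a ∈ b) y x}

/-- `H(θ)`: the sets whose transitive closure has size less than `θ`. -/
def hereditarySets (θ : Cardinal.{0}) : Set ZFSet.{0} :=
  {x | #(transitiveClosure x) < Cardinal.lift.{1, 0} θ}

/-- The only symbol of the language of set theory is the binary relation symbol for membership. -/
inductive SetRelation : ℕ → Type
  | mem : SetRelation 2

/-- The first-order language of set theory. -/
def setLanguage : FirstOrder.Language.{0, 0} := ⟨fun _ => Empty, SetRelation⟩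

/-- `(H(θ), ∈)` as a first-order structure. -/
instance hereditarySetsStructure (θ : Cardinal.{0}) :
    setLanguage.Structure (hereditarySets θ) where
  funMap := fun f => Empty.elim f
  RelMap := fun {_} r => match r with
    | SetRelation.mem => fun x => (x 0 : ZFSet.{0}) ∈ (x 1 : ZFSet.{0})

/-- `M` is a countable elementary submodel of `H(θ)`. -/
def IsCountableElementarySubmodel (M : Set ZFSet.{0}) (θ : Cardinal.{0}) : Prop :=
  M.Countable ∧ ∃ S : setLanguage.ElementarySubstructure (hereditarySets θ),
    M = Subtype.val '' (S : Set (hereditarySets θ))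

/-- The meaning of "sufficiently large" for `θ`: regular and larger than `2^{2^ω}`. -/
def IsSufficientlyLarge (θ : Cardinal.{0}) : Prop :=
  θ.IsRegular ∧ (2 : Cardinal.{0}) ^ ((2 : Cardinal.{0}) ^ ℵ₀) < θ

/-! ### The set-theoretic objects, as elements of the universe of sets -/

/-- A countable ordinal as a von Neumann ordinal. -/
def ordSet (ξ : OmegaOne) : ZFSet.{0} := ((Ordinal.ToType.toOrd ξ : Ordinal.{0})).toZFSet

/-- The set of all `c x` for `x ∈ s`. -/
def imageSet {α : Type} (c : α → ZFSet.{0}) (s : Set α) : ZFSet.{0} :=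
  ZFSet.range (fun x : s => c x)

/-- The function `f`, as a set of ordered pairs. -/
def graphSet {α β : Type} (c : α → ZFSet.{0}) (d : β → ZFSet.{0}) (f : α → β) : ZFSet.{0} :=
  ZFSet.range (fun x : α => ZFSet.pair (c x) (d (f x)))

/-- A real number as its left Dedekind cut, rationals being identified with natural numbers through
a fixed enumeration. -/
def realSet (r : ℝ) : ZFSet.{0} :=
  imageSet (fun q : ℚ => ((Encodable.encode q : ℕ) : Ordinal.{0}).toZFSet) {q : ℚ | (q : ℝ) < r}

/-- A finite set of countable ordinals, as a set. -/
def finOrdSet (F : Finset OmegaOne) : ZFSet.{0} := imageSet ordSet (F : Set OmegaOne)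

/-- A finite set of reals, as a set. -/
def finRealSet (H : Finset ℝ) : ZFSet.{0} := imageSet realSet (H : Set ℝ)

/-- The base `𝒲`, as a set. -/
def ratBaseSet : ZFSet.{0} := imageSet (imageSet finRealSet) ratBase

/-! ### The construction -/

/-- The topology `τ_α` on `α + 1 = {ξ : ξ ≤ α}`. -/
@[reducible] def stageTopology (U : OmegaOne → OmegaOne → Set OmegaOne) (φ : OmegaOne → OmegaOne → Finset ℝ)
    (α : OmegaOne) : TopologicalSpace (Iic α) :=
  TopologicalSpace.generateFrom
    ({S | ∃ γ ≤ α, S = {ξ : Iic α | (ξ : OmegaOne) ∈ U α γ}} ∪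
      {S | ∃ W ∈ ratBase, S = {ξ : Iic α | φ α ξ ∈ W}})

/-- `U^α_F`, the intersection of the `U^α_γ` for `γ ∈ F`, taken inside `α + 1`. -/
def stageInter (U : OmegaOne → OmegaOne → Set OmegaOne) (α : OmegaOne) (F : Finset OmegaOne) :
    Set OmegaOne :=
  {ξ | ξ ≤ α ∧ ∀ γ ∈ F, ξ ∈ U α γ}

/-- The set `T_α` of those `β ≤ α` at which `B_β`, `φ_β` and `{U^β_γ}_{γ < β}` are the traces, on a
countable elementary submodel `M` with `M ∩ ω₁ = β`, of objects that belong to `M`. -/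
def guessSet (B : OmegaOne → Set (Finset OmegaOne)) (U : OmegaOne → OmegaOne → Set OmegaOne)
    (φ : OmegaOne → OmegaOne → Finset ℝ) (α : OmegaOne) : Set OmegaOne :=
  {β | β ≤ α ∧
    (∀ F ∈ B β, (F : Set OmegaOne) ⊆ Iio β) ∧ (B β).PairwiseDisjoint id ∧
    ∃ (θ : Cardinal.{0}) (M : Set ZFSet.{0}),
      IsSufficientlyLarge θ ∧ IsCountableElementarySubmodel M θ ∧
      {ξ : OmegaOne | ordSet ξ ∈ M} = Iio β ∧
      ratBaseSet ∈ M ∧ graphSet ordSet (imageSet finOrdSet) B ∈ M ∧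
      (∃ f : OmegaOne → Finset ℝ, graphSet ordSet finRealSet f ∈ M ∧ ∀ ξ < β, f ξ = φ β ξ) ∧
      (∃ S : Set (Finset OmegaOne), ¬ S.Countable ∧ imageSet finOrdSet S ∈ M ∧
        {F | F ∈ S ∧ finOrdSet F ∈ M} = B β) ∧
      (∃ V : OmegaOne → Set OmegaOne, graphSet ordSet (imageSet ordSet) V ∈ M ∧
        ∀ γ < β, V γ ∩ Iio β = U β γ ∩ Iio β)}

/-- The families `{U^α_γ}_{γ ≤ α}` and `φ_α : α + 1 → [ℝ]^{<ω}` (for `α < ω₁`) carry out the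
construction for the sequences `{C_α}` and `{B_γ}`. Only the values `U α γ` for `γ ≤ α` and `φ α ξ`
for `ξ ≤ α` are relevant. -/
structure IsConstruction (C : OmegaOne → Set OmegaOne) (B : OmegaOne → Set (Finset OmegaOne))
    (U : OmegaOne → OmegaOne → Set OmegaOne) (φ : OmegaOne → OmegaOne → Finset ℝ) : Prop where
  subset : ∀ α, ∀ γ ≤ α, U α γ ⊆ Iic α
  self : ∀ α, U α α = Iic α
  disjoint : ∀ α, (Iic α).PairwiseDisjoint (φ α)
  coherent : ∀ α α₀, α ≤ α₀ → ∀ γ ≤ α, U α γ = U α₀ γ ∩ Iic α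
  coherent_map : ∀ α α₀, α ≤ α₀ → ∀ ξ ≤ α, φ α ξ = φ α₀ ξ
  not_cover : ∀ α, @IsClosedDiscrete _ (stageTopology U φ α) {ξ : Iic α | (ξ : OmegaOne) ∈ C α} →
    (⋃ γ ∈ C α, U α γ) ≠ Iic α
  network : ∀ α, ∀ β : Iic α, (β : OmegaOne) ∈ guessSet B U φ α →
    @IsLocalPiNetwork _ (stageTopology U φ α)
      {N | ∃ F ∈ B β, N = {ξ : Iic α | (ξ : OmegaOne) ∈ F}} β
  omega_cover : ∀ α, ∀ β : Iic α, (β : OmegaOne) ∈ guessSet B U φ α → (β : OmegaOne) < α →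
    ∀ V : Set (Iic α), IsOpen[stageTopology U φ α] V → β ∈ V →
      IsOmegaCover
        {S | ∃ F ∈ B β, (F : Set OmegaOne) ⊆ Subtype.val '' V ∧ S = stageInter U α F}
        (Ioc (β : OmegaOne) α)

/-- `U_γ = ⋃ {U^α_γ : γ ≤ α < ω₁}`. -/
def limitSet (U : OmegaOne → OmegaOne → Set OmegaOne) (γ : OmegaOne) : Set OmegaOne :=
  ⋃ α ∈ Ici γ, U α γ

/-- `φ = ⋃ {φ_α : α < ω₁}`; its value at `ξ` is `φ_ξ(ξ)`, as the `φ_α` extend each other. -/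
def limitMap (φ : OmegaOne → OmegaOne → Finset ℝ) (ξ : OmegaOne) : Finset ℝ := φ ξ ξ

/-- `U_F`, the intersection of the `U_γ` for `γ ∈ F`. -/
def limitInter (U : OmegaOne → OmegaOne → Set OmegaOne) (F : Finset OmegaOne) : Set OmegaOne :=
  ⋂ γ ∈ F, limitSet U γ

/-- The topology `τ` of the constructed space on `ω₁`. -/
@[reducible] def limitTopology (U : OmegaOne → OmegaOne → Set OmegaOne) (φ : OmegaOne → OmegaOne → Finset ℝ) :
    TopologicalSpace OmegaOne :=
  TopologicalSpace.generateFrom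
    ({S | ∃ γ, S = limitSet U γ} ∪ {S | ∃ W ∈ ratBase, S = {ξ | limitMap φ ξ ∈ W}})

end

/-!
# A hereditarily `(ε)` and hereditarily Lindelöf space from `◇`
-/

noncomputable section

/-! ### Clubs and `◇` -/

namespace OmegaOne

/-! The existence of a construction is the harder half (`PointData.exists_good_update`). A recursion
decides at each `α` the value `φ(α)` and the set of `γ < α` with `α ∈ U_γ`. If `α` is guessed by a
submodel `M` and an uncountable family `X ∈ M` with `M ∩ X = B_α`, pick a finite `H ∈ X \ M`.
Disjointness of `B_α` and elementarity force `H` above `α`, and whatever `H(θ)` says of `H` with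
parameters in `M` also holds of some `F ∈ B_α` (`exists_generic_finset`). The new point imitates
`H`: `φ(α)` collects the values on `H` of the function in `M` that extends `φ` below `α`, plus one
fresh real, and `α` may enter `U_γ` only if `H ⊆ V_γ`. A basic neighbourhood of `α` thus gives one
containing `H`, which reflects to a member of `B_α`; this is (4a).

For (4b) at `β < α`, some `E ∈ B_β` must serve `H` together with given points between `β` and `α`.
Otherwise this failure reflects to some `F ∈ B_α` above `β`, although `F` consists of earlier
points, for which the recursion has provided an `E`. For (3), `α` is left out of `U_γ` for `γ ∈
C_α`. This is harmless: the neighbourhood of `β` can be shrunk to meet `C_α` at most in `β`, and `E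
⊆ β`.

For (i), a chain of Skolem hulls and stationarity yield `β` such that `B_β` is the trace of the
given family on a suitable submodel (`IsConstruction.exists_guessed`). Then (4b), with the whole
space as `V`, gives an `ω`-cover of the points above `β`; a point `ξ ≤ β` lies in `U_F` for any `F`
in the family that misses `ξ`.

Finally (i) implies (ii) and (iii) through finite powers. As `𝒲` is countable, only products of sets
`U_F` matter. They are treated by induction on the number of factors and the total size of the index
sets (`exists_countable_subfamily_interProd`). -/

theorem countable_Iio (α : OmegaOne) : (Iio α).Countable := by
  have h : ∀ o : Ordinal.{0}, o = (ℵ₁).ord → ∀ α : o.ToType, (Iio α).Countable := by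
    rintro o rfl α
    have := Cardinal.mk_Iio_lt α (by simp)
    rw [Cardinal.mk_ord_toType] at this
    exact Cardinal.le_aleph0_iff_set_countable.1 (Cardinal.lt_aleph_one_iff.1 this)
  exact h _ (Cardinal.ord_aleph 1).symm α

theorem not_countable_univ : ¬ (univ : Set OmegaOne).Countable := by
  intro h
  have h1 : #OmegaOne ≤ ℵ₀ := by
    rw [← Cardinal.mk_univ]; exact Cardinal.le_aleph0_iff_set_countable.2 h
  rw [Cardinal.mk_toType, Ordinal.card_omega] at h1
  exact absurd h1 (not_le.2 Cardinal.aleph0_lt_aleph_one)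

theorem countable_Iic (α : OmegaOne) : (Iic α).Countable := by
  rw [← Iio_insert]
  exact (countable_Iio α).insert α

theorem exists_forall_lt {s : Set OmegaOne} (hs : s.Countable) : ∃ δ, ∀ ξ ∈ s, ξ < δ := by
  by_contra! h
  refine not_countable_univ ((hs.biUnion fun ξ _ => countable_Iic ξ).mono fun δ _ => ?_)
  obtain ⟨ξ, hξ, hle⟩ := h δ
  exact mem_biUnion hξ hle

/-- The points closed under a function form a club. -/
theorem isClub_closed (g : OmegaOne → OmegaOne) :
    IsClub {β : OmegaOne | (∃ γ, γ < β) ∧ ∀ γ < β, g γ < β} := by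
  refine ⟨?_, fun α => ?_⟩
  · intro t ht ht0 _ b hb
    have key : ∀ γ < b, ∃ c ∈ t, γ < c := fun γ hγ => (lt_isLUB_iff hb).1 hγ
    obtain ⟨c, hc⟩ := ht0
    obtain ⟨γ, hγ⟩ := (ht hc).1
    refine ⟨⟨γ, hγ.trans_le (hb.1 hc)⟩, fun γ hγ => ?_⟩
    obtain ⟨c, hc, hlt⟩ := key γ hγ
    exact ((ht hc).2 γ hlt).trans_le (hb.1 hc)
  · have step : ∀ δ : OmegaOne, ∃ δ', δ < δ' ∧ ∀ γ ≤ δ, g γ < δ' := fun δ => by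
      obtain ⟨δ', h⟩ := exists_forall_lt (((countable_Iic δ).image g).insert δ)
      exact ⟨δ', h _ (mem_insert _ _),
        fun γ hγ => h _ (mem_insert_of_mem _ (mem_image_of_mem g hγ))⟩
    choose s hs hs' using step
    let a : ℕ → OmegaOne := fun n => s^[n] α
    have ha : ∀ n, a (n + 1) = s (a n) := fun n => Function.iterate_succ_apply' s n α
    obtain ⟨u, hu⟩ := exists_forall_lt (countable_range a)
    -- The least strict upper bound, so that everything below `b` is at most some `a n`.
    let b := wellFounded_lt.min {u | ∀ n, a n < u} ⟨u, fun n => hu _ (mem_range_self n)⟩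
    have hb : ∀ n, a n < b := wellFounded_lt.min_mem {u | ∀ n, a n < u} _
    refine ⟨b, ⟨⟨a 0, hb 0⟩, fun γ hγ => ?_⟩, (hb 0).le⟩
    have : ¬ ∀ n, a n < γ := fun h => wellFounded_lt.not_lt_min {u | ∀ n, a n < u} h hγ
    push Not at this
    obtain ⟨n, hn⟩ := this
    calc g γ < s (a n) := hs' _ _ hn
      _ = a (n + 1) := (ha n).symm
      _ < b := hb _

theorem exists_mem_stationary_closed {T : Set OmegaOne} (hT : IsStationary T)
    (g : OmegaOne → OmegaOne) : ∃ β ∈ T, (∃ γ, γ < β) ∧ ∀ γ < β, g γ < β := by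
  obtain ⟨β, h1, h2⟩ := hT (isClub_closed g)
  exact ⟨β, h1, h2⟩

end OmegaOne

open OmegaOne

/-- The `♢`-sequence is itself such an enumeration: a countable set is guessed at some `β` beyond a
bound for it, and there the guess is the whole set. -/
theorem exists_isCountableSetEnumeration (h : Diamond) :
    ∃ C : OmegaOne → Set OmegaOne, IsCountableSetEnumeration C := by
  obtain ⟨A, hA, hst⟩ := h
  refine ⟨A, hA, fun X => ⟨fun hX => ?_, ?_⟩⟩
  · obtain ⟨δ, hδ⟩ := exists_forall_lt hX
    obtain ⟨β, hβ, ⟨γ, hγ⟩, hcl⟩ := exists_mem_stationary_closed (hst X) (fun _ => δ)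
    refine ⟨β, hβ.symm.trans (inter_eq_left.2 fun ξ hξ => (hδ ξ hξ).trans (hcl γ hγ))⟩
  · rintro ⟨α, rfl⟩
    exact (countable_Iio α).mono (hA α)

theorem finset_subset_Iic_of_closed {β : OmegaOne} (hβ : ∃ γ, γ < β) {F : Finset OmegaOne}
    (hF : (F : Set OmegaOne) ⊆ Iio β) : ∃ γ < β, (F : Set OmegaOne) ⊆ Iic γ := by
  rcases F.eq_empty_or_nonempty with rfl | hne
  · obtain ⟨γ, hγ⟩ := hβ
    exact ⟨γ, hγ, by simp⟩
  · exact ⟨F.max' hne, hF (F.max'_mem hne), fun ξ hξ => F.le_max' ξ hξ⟩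

theorem countable_finset_subset {s : Set OmegaOne} (hs : s.Countable) :
    {F : Finset OmegaOne | (F : Set OmegaOne) ⊆ s}.Countable := by
  refine ((countable_ofPred_finite_subset hs).preimage_of_injOn
    (f := fun F : Finset OmegaOne => (F : Set OmegaOne)) Finset.coe_injective.injOn).mono
    fun F hF => ?_
  exact ⟨F.finite_toSet, hF⟩

/-- Finite sets are coded by points through a bijection `e`. On a club of `β`, `e` sends the finite
subsets of `β` below `β`, so guessing `e '' S` below `β` amounts to guessing the trace of `S`. -/
theorem exists_isFinsetDiamondSequence (h : Diamond) :
    ∃ B : OmegaOne → Set (Finset OmegaOne), IsFinsetDiamondSequence B := by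
  obtain ⟨A, hA, hst⟩ := h
  obtain ⟨e⟩ : Nonempty (Finset OmegaOne ≃ OmegaOne) := by
    have : Infinite OmegaOne := infinite_univ_iff.1 fun h => not_countable_univ h.countable
    exact Cardinal.eq.1 (Cardinal.mk_finset_of_infinite OmegaOne)
  have hg : ∀ γ : OmegaOne, ∃ δ, ∀ F : Finset OmegaOne, (F : Set OmegaOne) ⊆ Iic γ → e F < δ := by
    intro γ
    obtain ⟨δ, hδ⟩ := exists_forall_lt ((countable_finset_subset (countable_Iic γ)).image e)
    exact ⟨δ, fun F hF => hδ _ (mem_image_of_mem e hF)⟩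
  choose g hg using hg
  refine ⟨fun β => {F | (F : Set OmegaOne) ⊆ Iio β ∧ e F ∈ A β}, fun S _ t ht => ?_⟩
  have hcof : Order.cof OmegaOne ≠ ℵ₀ := by
    rw [Ordinal.cof_toType, Cardinal.cof_omega_one]
    exact Cardinal.aleph0_lt_aleph_one.ne'
  obtain ⟨β, hβ, hβt, hne, hcl⟩ := hst (e '' S) (ht.inter hcof (isClub_closed g))
  refine ⟨β, ?_, hβt⟩
  ext F
  simp only [mem_ofPred_eq] at hβ ⊢
  rw [← hβ, and_comm]
  refine and_congr_right fun hF => ?_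
  obtain ⟨γ, hγ, hFγ⟩ := finset_subset_Iic_of_closed hne hF
  have : e F < β := (hg γ F hFγ).trans (hcl γ hγ)
  simp [this]

section

open FirstOrder FirstOrder.Language

/-! ### Definable predicates over an elementary submodel of `H(θ)` -/

section Definability

variable {θ : Cardinal.{0}} {A : Set (hereditarySets θ)}

/-- The membership symbol. -/
def memRelation : setLanguage.Relations 2 := SetRelation.mem

theorem hereditarySets_trans {x y : ZFSet.{0}} (hx : x ∈ hereditarySets θ) (hy : y ∈ x) :
    y ∈ hereditarySets θ := by
  refine lt_of_le_of_lt (Cardinal.mk_le_mk_of_subset fun z hz => ?_) hx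
  exact Relation.TransGen.tail hz hy

variable (A) in
/-- The predicate `P` on sequences of sets is definable in `H(θ)` from parameters in `A`. -/
def DefPred (P : (ℕ → ZFSet.{0}) → Prop) : Prop :=
  A.Definable setLanguage {v : ℕ → hereditarySets θ | P fun i => v i}

variable (A) in
/-- The function `t` on sequences of sets is definable in `H(θ)` from parameters in `A`. -/
def DefTerm (t : (ℕ → ZFSet.{0}) → ZFSet.{0}) : Prop :=
  ∃ t' : (ℕ → hereditarySets θ) → hereditarySets θ, A.DefinableFun setLanguage t' ∧
    ∀ v, (t' v : ZFSet.{0}) = t fun i => v i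

namespace DefPred

theorem of_definable {P : (ℕ → ZFSet.{0}) → Prop} {s : Set (ℕ → hereditarySets θ)}
    (hs : A.Definable setLanguage s) (h : ∀ v, v ∈ s ↔ P fun i => v i) : DefPred A P := by
  have : s = {v : ℕ → hereditarySets θ | P fun i => v i} := ext h
  rw [DefPred, ← this]
  exact hs

theorem var (i : ℕ) : DefTerm A (fun v => v i) :=
  ⟨fun v => v i, DefinableFun.proj _, fun _ => rfl⟩

theorem const {a : ZFSet.{0}} (ha : a ∈ Subtype.val '' A) : DefTerm A (fun _ => a) := by
  obtain ⟨a, ha, rfl⟩ := ha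
  exact ⟨fun _ => a, definableFun_const _ _ ha, fun _ => rfl⟩

theorem _root_.DefTerm.comp {t : (ℕ → ZFSet.{0}) → ZFSet.{0}} (h : DefTerm A t) (f : ℕ → ℕ) :
    DefTerm A (fun v => t fun i => v (f i)) := by
  obtain ⟨t', ht', h⟩ := h
  exact ⟨fun v => t' fun i => v (f i), Definable.preimage_comp (Option.map f) ht', fun v => h _⟩

theorem not {P : (ℕ → ZFSet.{0}) → Prop} (h : DefPred A P) : DefPred A (fun v => ¬ P v) :=
  Definable.compl h

theorem and {P Q : (ℕ → ZFSet.{0}) → Prop} (hP : DefPred A P) (hQ : DefPred A Q) :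
    DefPred A (fun v => P v ∧ Q v) :=
  Definable.inter hP hQ

theorem or {P Q : (ℕ → ZFSet.{0}) → Prop} (hP : DefPred A P) (hQ : DefPred A Q) :
    DefPred A (fun v => P v ∨ Q v) :=
  Definable.union hP hQ

theorem imp {P Q : (ℕ → ZFSet.{0}) → Prop} (hP : DefPred A P) (hQ : DefPred A Q) :
    DefPred A (fun v => P v → Q v) :=
  Definable.himp hP hQ

theorem finset_all {ι : Type*} (s : Finset ι) {P : ι → (ℕ → ZFSet.{0}) → Prop}
    (h : ∀ i ∈ s, DefPred A (P i)) : DefPred A (fun v => ∀ i ∈ s, P i v) := by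
  classical
  induction s using Finset.induction with
  | empty =>
    exact of_definable definable_univ fun v => by simp
  | insert i s _ ih =>
    simp only [Finset.forall_mem_insert] at h ⊢
    exact h.1.and (ih h.2)

theorem comp {P : (ℕ → ZFSet.{0}) → Prop} (h : DefPred A P) (f : ℕ → ℕ) :
    DefPred A (fun v => P fun i => v (f i)) :=
  Definable.preimage_comp f h

theorem mem {s t : (ℕ → ZFSet.{0}) → ZFSet.{0}} (hs : DefTerm A s) (ht : DefTerm A t) :
    DefPred A (fun v => s v ∈ t v) := by
  obtain ⟨s', hs', hs⟩ := hs
  obtain ⟨t', ht', ht⟩ := ht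
  have h2 : A.Definable setLanguage
      {v : Fin 2 → hereditarySets θ | (v 0 : ZFSet.{0}) ∈ (v 1 : ZFSet.{0})} := by
    refine Definable.mono (A := ∅) (empty_definable_iff.2
      ⟨memRelation.formula₂ (Term.var 0) (Term.var 1), ?_⟩)
      (empty_subset _)
    ext v
    simp only [mem_ofPred_eq]
    rw [Formula.realize_rel₂]
    rfl
  have := Definable.preimage_map (F := fun v => ![s' v, t' v]) (L := setLanguage) (A := A)
    (fun i => by fin_cases i <;> assumption) h2
  refine of_definable this fun v => ?_
  simp [← hs, ← ht]

theorem eq {s t : (ℕ → ZFSet.{0}) → ZFSet.{0}} (hs : DefTerm A s) (ht : DefTerm A t) :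
    DefPred A (fun v => s v = t v) := by
  obtain ⟨s', hs', hs⟩ := hs
  obtain ⟨t', ht', ht⟩ := ht
  have h2 : A.Definable setLanguage {v : Fin 2 → hereditarySets θ | v 0 = v 1} :=
    Definable.diagonal setLanguage A
  have := Definable.preimage_map (F := fun v => ![s' v, t' v]) (L := setLanguage) (A := A)
    (fun i => by fin_cases i <;> assumption) h2
  refine of_definable this fun v => ?_
  simp [← hs, ← ht, Subtype.ext_iff]

/-- Variables are de Bruijn indices: the bound one is `v 0` and the others shift by one. As `H(θ)`
is transitive, a bounded quantifier means the same in `H(θ)` and in the universe. -/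
theorem bex {t : (ℕ → ZFSet.{0}) → ZFSet.{0}} (ht : DefTerm A t)
    {P : ZFSet.{0} → (ℕ → ZFSet.{0}) → Prop}
    (h : DefPred A fun v => P (v 0) fun i => v (i + 1)) :
    DefPred A fun v => ∃ x ∈ t v, P x v := by
  have hs := ht.comp (· + 1)
  obtain ⟨t', ht', ht⟩ := ht
  let s : (ℕ → ZFSet.{0}) → ZFSet.{0} := fun v => t fun i => v (i + 1)
  have h1 := ((mem (var 0) hs).and h)
  let f : ℕ → ℕ ⊕ Unit := fun n => Nat.casesOn n (.inr ()) .inl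
  have h2 := Definable.exists_of_finite (Definable.preimage_comp f h1)
  refine of_definable h2 fun v => ?_
  simp only [mem_ofPred_eq]
  constructor
  · rintro ⟨u, hu, hP⟩
    exact ⟨u (), hu, hP⟩
  · rintro ⟨x, hx, hP⟩
    have hx' := hx
    rw [← ht] at hx'
    exact ⟨fun _ => ⟨x, hereditarySets_trans (t' v).2 hx'⟩, hx, hP⟩

theorem ball {t : (ℕ → ZFSet.{0}) → ZFSet.{0}} (ht : DefTerm A t)
    {P : ZFSet.{0} → (ℕ → ZFSet.{0}) → Prop}
    (h : DefPred A fun v => P (v 0) fun i => v (i + 1)) :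
    DefPred A fun v => ∀ x ∈ t v, P x v := by
  have := (bex ht (P := fun x v => ¬ P x v) h.not).not
  simpa using this

theorem singleton {s t : (ℕ → ZFSet.{0}) → ZFSet.{0}} (hs : DefTerm A s) (ht : DefTerm A t) :
    DefPred A (fun v => s v = {t v}) := by
  have h := (mem ht hs).and (ball hs (P := fun x v => x = t v) (eq (var 0) (ht.comp _)))
  refine of_definable h fun v => ?_
  refine ⟨fun h => ?_, fun h => by simp [h]⟩
  ext z
  rw [ZFSet.mem_singleton]
  exact ⟨h.2 z, fun hz => hz ▸ h.1⟩

theorem doubleton {s t u : (ℕ → ZFSet.{0}) → ZFSet.{0}} (hs : DefTerm A s) (ht : DefTerm A t)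
    (hu : DefTerm A u) : DefPred A (fun v => s v = {t v, u v}) := by
  have h := ((mem ht hs).and (mem hu hs)).and (ball hs (P := fun x v => x = t v ∨ x = u v)
    ((eq (var 0) (ht.comp _)).or (eq (var 0) (hu.comp _))))
  refine of_definable h fun v => ?_
  refine ⟨fun h => ?_, fun h => by simp [h]⟩
  ext z
  rw [ZFSet.mem_pair]
  exact ⟨h.2 z, fun hz => hz.elim (fun e => e ▸ h.1.1) (fun e => e ▸ h.1.2)⟩

theorem pair {s t u : (ℕ → ZFSet.{0}) → ZFSet.{0}} (hs : DefTerm A s) (ht : DefTerm A t)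
    (hu : DefTerm A u) : DefPred A (fun v => s v = ZFSet.pair (t v) (u v)) := by
  have h1 := singleton (var 0) (ht.comp (· + 1))
  have h2 := doubleton (var 0) (ht.comp (· + 1)) (hu.comp (· + 1))
  have h := ((bex hs (P := fun x v => x = {t v}) h1).and
    (bex hs (P := fun x v => x = {t v, u v}) h2)).and
    (ball hs (P := fun x v => x = {t v} ∨ x = {t v, u v}) (h1.or h2))
  refine of_definable h fun v => ?_
  simp only [mem_ofPred_eq, exists_eq_right, ZFSet.pair]
  refine ⟨fun h => ?_, fun h => by simp [h]⟩
  ext z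
  rw [ZFSet.mem_pair]
  exact ⟨h.2 z, fun hz => hz.elim (fun e => e ▸ h.1.1) (fun e => e ▸ h.1.2)⟩

theorem insert_self {s t : (ℕ → ZFSet.{0}) → ZFSet.{0}} (hs : DefTerm A s) (ht : DefTerm A t) :
    DefPred A (fun v => s v = insert (t v) (t v)) := by
  have h := ((mem ht hs).and (ball ht (P := fun x v => x ∈ s v) (mem (var 0) (hs.comp _)))).and
    (ball hs (P := fun x v => x = t v ∨ x ∈ t v)
      ((eq (var 0) (ht.comp _)).or (mem (var 0) (ht.comp _))))
  refine of_definable h fun v => ?_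
  refine ⟨fun h => ?_, fun h => by simp +contextual [h]⟩
  ext z
  rw [ZFSet.mem_insert_iff]
  exact ⟨h.2 z, fun hz => hz.elim (fun e => e ▸ h.1.1) (h.1.2 z)⟩

theorem isEmpty {s : (ℕ → ZFSet.{0}) → ZFSet.{0}} (hs : DefTerm A s) :
    DefPred A (fun v => s v = ∅) := by
  have h := (bex hs (P := fun x _ => x = x) (eq (var 0) (var 0))).not
  refine of_definable h fun v => ?_
  simp [ZFSet.eq_empty]

/-- The quantifiers are bounded in disguise: both coordinates lie in the element `{x, y}` of the
pair. -/
theorem exists_pair {t : (ℕ → ZFSet.{0}) → ZFSet.{0}} (ht : DefTerm A t)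
    {P : ZFSet.{0} → ZFSet.{0} → (ℕ → ZFSet.{0}) → Prop}
    (h : DefPred A fun v => P (v 0) (v 1) fun i => v (i + 2)) :
    DefPred A fun v => ∃ x y, ZFSet.pair x y ∈ t v ∧ P x y v := by
  -- After four quantifiers `y, x, d, p` occupy the indices 0 to 3, so `x` and `y` trade places and
  -- the old variables start at 4.
  let f : ℕ → ℕ := fun n => Nat.casesOn n 1 fun n => Nat.casesOn n 0 fun n => n + 4
  have h4 : DefPred A fun v => v 3 = ZFSet.pair (v 1) (v 0) ∧ P (v 1) (v 0) fun i => v (i + 4) :=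
    (pair (var 3) (var 1) (var 0)).and (h.comp f)
  have h' := bex ht (P := fun p v => ∃ d ∈ p, ∃ x ∈ d, ∃ y ∈ d, p = ZFSet.pair x y ∧ P x y v) <|
    bex (var 0) (P := fun d v => ∃ x ∈ d, ∃ y ∈ d, v 0 = ZFSet.pair x y ∧
      P x y fun i => v (i + 1)) <|
    bex (var 0) (P := fun x v => ∃ y ∈ v 0, v 1 = ZFSet.pair x y ∧ P x y fun i => v (i + 2)) <|
    bex (var 1) (P := fun y v => v 2 = ZFSet.pair (v 0) y ∧ P (v 0) y fun i => v (i + 3)) h4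
  refine of_definable h' fun v => ?_
  simp only [mem_ofPred_eq]
  constructor
  · rintro ⟨p, hp, d, -, x, -, y, -, rfl, hP⟩
    exact ⟨x, y, hp, hP⟩
  · rintro ⟨x, y, hp, hP⟩
    exact ⟨_, hp, {x, y}, by simp [ZFSet.pair], x, by simp, y, by simp, rfl, hP⟩

theorem forall_pair {t : (ℕ → ZFSet.{0}) → ZFSet.{0}} (ht : DefTerm A t)
    {P : ZFSet.{0} → ZFSet.{0} → (ℕ → ZFSet.{0}) → Prop}
    (h : DefPred A fun v => P (v 0) (v 1) fun i => v (i + 2)) :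
    DefPred A fun v => ∀ x y, ZFSet.pair x y ∈ t v → P x y v := by
  have := (exists_pair ht (P := fun x y v => ¬ P x y v) h.not).not
  simpa using this

end DefPred
end Definability

end

section

open FirstOrder FirstOrder.Language

/-! ### Closure properties of `H(θ)` and of its elementary submodels -/

section ElementarySubmodels

variable {θ : Cardinal.{0}} {S : setLanguage.ElementarySubstructure (hereditarySets θ)}

/-- The Tarski–Vaught property, the one form in which elementarity is applied below. -/
theorem exists_mem_submodel {Q : ZFSet.{0} → Prop}
    (hQ : DefPred (S : Set (hereditarySets θ)) fun v => Q (v 0)) {x : ZFSet.{0}}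
    (hx : x ∈ hereditarySets θ) (hq : Q x) :
    ∃ y ∈ Subtype.val '' (S : Set (hereditarySets θ)), Q y := by
  have h1 : (S : Set (hereditarySets θ)).Definable₁ setLanguage {y | Q y} :=
    Definable.preimage_comp (fun _ : ℕ => (0 : Fin 1)) hQ
  obtain ⟨y, hy, hyS⟩ := S.meetsDefinable _ ⟨⟨x, hx⟩, hq⟩ h1
  exact ⟨y, ⟨y, hyS, rfl⟩, hy⟩

theorem hereditary_of_mem_submodel {x : ZFSet.{0}}
    (hx : x ∈ Subtype.val '' (S : Set (hereditarySets θ))) : x ∈ hereditarySets θ := by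
  obtain ⟨x, -, rfl⟩ := hx
  exact x.2

/-- The transitive closure of `x` is a union of fewer than `θ` sets of size less than `θ`, so
regularity applies. -/
theorem mem_hereditarySets_of_forall_mem (hθ : θ.IsRegular) {x : ZFSet.{0}}
    (hx : ∀ y ∈ x, y ∈ hereditarySets θ)
    (hc : #{y | y ∈ x} < Cardinal.lift.{1, 0} θ) : x ∈ hereditarySets θ := by
  have hθ' : (Cardinal.lift.{1, 0} θ).IsRegular := hθ.lift
  have hsub : transitiveClosure x ⊆ ⋃ y ∈ {y | y ∈ x}, insert y (transitiveClosure y) := by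
    intro z hz
    rcases (Relation.TransGen.tail'_iff (r := fun a b : ZFSet.{0} => a ∈ b)).1 hz with ⟨y, hzy, hy⟩
    refine mem_biUnion hy ?_
    rcases Relation.reflTransGen_iff_eq_or_transGen.1 hzy with rfl | h
    · exact mem_insert _ _
    · exact mem_insert_of_mem _ h
  refine (Cardinal.mk_le_mk_of_subset hsub).trans_lt
    ((Cardinal.card_biUnion_lt_iff_forall_of_isRegular hθ' hc).2 fun y hy => ?_)
  exact (Cardinal.mk_insert_le).trans_lt
    (Cardinal.add_lt_of_lt hθ'.aleph0_le (hx y hy) (Cardinal.one_lt_aleph0.trans_le hθ'.aleph0_le))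

theorem mem_hereditarySets_of_countable (hθ : θ.IsRegular) (hθ₀ : ℵ₀ < θ) {x : ZFSet.{0}}
    (hx : ∀ y ∈ x, y ∈ hereditarySets θ) (hc : {y | y ∈ x}.Countable) : x ∈ hereditarySets θ :=
  mem_hereditarySets_of_forall_mem hθ hx
    ((Cardinal.le_aleph0_iff_set_countable.2 hc).trans_lt (by simpa using hθ₀))

theorem pair_mem_hereditarySets (hθ : θ.IsRegular) (hθ₀ : ℵ₀ < θ) {x y : ZFSet.{0}}
    (hx : x ∈ hereditarySets θ) (hy : y ∈ hereditarySets θ) :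
    ZFSet.pair x y ∈ hereditarySets θ := by
  have h2 : ∀ {a b : ZFSet.{0}}, a ∈ hereditarySets θ → b ∈ hereditarySets θ →
      ({a, b} : ZFSet.{0}) ∈ hereditarySets θ := fun {a b} ha hb =>
    mem_hereditarySets_of_countable hθ hθ₀
      (fun z hz => by rcases ZFSet.mem_pair.1 hz with rfl | rfl <;> assumption)
      (((countable_singleton b).insert a).mono fun z hz => ZFSet.mem_pair.1 hz)
  have h1 := h2 hx hx
  rw [ZFSet.pair_eq_singleton] at h1
  exact h2 h1 (h2 hx hy)

theorem empty_mem_submodel (hθ : θ.IsRegular) (hθ₀ : ℵ₀ < θ) :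
    (∅ : ZFSet.{0}) ∈ Subtype.val '' (S : Set (hereditarySets θ)) := by
  obtain ⟨y, hy, rfl⟩ := exists_mem_submodel (S := S) (Q := fun x => x = ∅)
    (DefPred.isEmpty (DefPred.var 0))
    (mem_hereditarySets_of_countable hθ hθ₀ (by simp) (by simp)) rfl
  exact hy

theorem insert_self_mem_hereditarySets (hθ : θ.IsRegular) (hθ₀ : ℵ₀ < θ) {x : ZFSet.{0}}
    (hx : x ∈ hereditarySets θ) : insert x x ∈ hereditarySets θ := by
  have hθ₁ : (1 : Cardinal.{1}) < Cardinal.lift.{1, 0} θ := by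
    simpa using Cardinal.one_lt_aleph0.trans hθ₀
  refine mem_hereditarySets_of_forall_mem hθ (fun y hy => ?_) ?_
  · rcases ZFSet.mem_insert_iff.1 hy with rfl | hy
    exacts [hx, hereditarySets_trans hx hy]
  · have : {y | y ∈ insert x x} = insert x {y : ZFSet.{0} | y ∈ x} := by
      ext; simp
    rw [this]
    refine Cardinal.mk_insert_le.trans_lt (Cardinal.add_lt_of_lt (by simpa using hθ₀.le) ?_ hθ₁)
    exact (Cardinal.mk_le_mk_of_subset fun z hz => Relation.TransGen.single hz).trans_lt hx

theorem insert_self_mem_submodel (hθ : θ.IsRegular) (hθ₀ : ℵ₀ < θ) {x : ZFSet.{0}}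
    (hx : x ∈ Subtype.val '' (S : Set (hereditarySets θ))) :
    insert x x ∈ Subtype.val '' (S : Set (hereditarySets θ)) := by
  obtain ⟨y, hy, rfl⟩ := exists_mem_submodel (S := S) (Q := fun y => y = insert x x)
    (DefPred.insert_self (DefPred.var 0) (DefPred.const hx))
    (insert_self_mem_hereditarySets hθ hθ₀ (hereditary_of_mem_submodel hx)) rfl
  exact hy

/-- The elements of a countable element of an elementary submodel belong to it. -/
theorem mem_submodel_of_mem_countable (hθ : θ.IsRegular) (hθ₀ : ℵ₀ < θ) {a w : ZFSet.{0}}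
    (ha : a ∈ Subtype.val '' (S : Set (hereditarySets θ))) (hc : {x | x ∈ a}.Countable)
    (hw : w ∈ a) : w ∈ Subtype.val '' (S : Set (hereditarySets θ)) := by
  obtain ⟨e, he⟩ := hc.exists_eq_range ⟨w, hw⟩
  have he' : ∀ x, x ∈ a ↔ ∃ n, e n = x := fun x => by
    rw [← mem_range, ← he]; rfl
  let nat : ℕ → ZFSet.{0} := fun n => (n : Ordinal.{0}).toZFSet
  have nat_zero : nat 0 = ∅ := by simp [nat]
  have nat_succ : ∀ n, nat (n + 1) = insert (nat n) (nat n) := fun n => by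
    simp [nat, Ordinal.toZFSet_add_one]
  have nat_inj : Function.Injective nat := fun m n h => by
    simpa [nat] using Ordinal.toZFSet_injective h
  let g : ZFSet.{0} := ZFSet.range fun n : ℕ => ZFSet.pair (nat n) (e n)
  have mem_g : ∀ x y, ZFSet.pair x y ∈ g ↔ ∃ n, nat n = x ∧ e n = y := fun x y => by
    simp [g, ZFSet.pair_inj]
  -- `x` is a function whose values include all of `a` and whose arguments are empty or successors
  -- of arguments. The last clause replaces a reference to `ω`: by `∈`-induction it puts every
  -- argument into the submodel.
  let Q : ZFSet.{0} → Prop := fun x =>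
    ((∀ z ∈ a, ∃ n y, ZFSet.pair n y ∈ x ∧ y = z) ∧
      (∀ n y, ZFSet.pair n y ∈ x →
        n = ∅ ∨ ∃ m z, ZFSet.pair m z ∈ x ∧ n = insert m m)) ∧
      ∀ n y, ZFSet.pair n y ∈ x → ∀ m z, ZFSet.pair m z ∈ x → n = m → y = z
  have hQ : DefPred (S : Set (hereditarySets θ)) fun v => Q (v 0) := by
    refine ((DefPred.ball (DefPred.const ha) ?_).and (DefPred.forall_pair (DefPred.var 0) ?_)).and
      (DefPred.forall_pair (DefPred.var 0) ?_)
    · exact DefPred.exists_pair (DefPred.var 1) (DefPred.eq (DefPred.var 1) (DefPred.var 2))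
    · exact (DefPred.isEmpty (DefPred.var 0)).or (DefPred.exists_pair (DefPred.var 2)
        (DefPred.insert_self (DefPred.var 2) (DefPred.var 0)))
    · exact DefPred.forall_pair (DefPred.var 2)
        ((DefPred.eq (DefPred.var 2) (DefPred.var 0)).imp
          (DefPred.eq (DefPred.var 3) (DefPred.var 1)))
  have hgH : g ∈ hereditarySets θ := by
    have hnat : ∀ n, nat n ∈ hereditarySets θ := fun n => by
      induction n with
      | zero => exact nat_zero ▸ hereditary_of_mem_submodel (empty_mem_submodel (S := S) hθ hθ₀)
      | succ n ih => exact nat_succ n ▸ insert_self_mem_hereditarySets hθ hθ₀ ih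
    refine mem_hereditarySets_of_countable hθ hθ₀ (fun y hy => ?_) ?_
    · obtain ⟨n, rfl⟩ := ZFSet.mem_range.1 hy
      exact pair_mem_hereditarySets hθ hθ₀ (hnat n)
        (hereditarySets_trans (hereditary_of_mem_submodel ha) ((he' _).2 ⟨n, rfl⟩))
    · refine (countable_range fun n : ℕ => ZFSet.pair (nat n) (e n)).mono fun y hy => ?_
      exact ZFSet.mem_range.1 hy
  have hQg : Q g := by
    refine ⟨⟨fun z hz => ?_, fun n y h => ?_⟩, fun n y h m z h' => ?_⟩
    · obtain ⟨n, rfl⟩ := (he' z).1 hz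
      exact ⟨nat n, e n, (mem_g _ _).2 ⟨n, rfl, rfl⟩, rfl⟩
    · obtain ⟨n, rfl, rfl⟩ := (mem_g _ _).1 h
      rcases n with _ | n
      · exact .inl nat_zero
      · exact .inr ⟨nat n, e n, (mem_g _ _).2 ⟨n, rfl, rfl⟩, nat_succ n⟩
    · obtain ⟨n, rfl, rfl⟩ := (mem_g _ _).1 h
      obtain ⟨m, rfl, rfl⟩ := (mem_g _ _).1 h'
      exact fun h => congrArg e (nat_inj h)
  obtain ⟨x, hx, ⟨h1, h2⟩, h3⟩ := exists_mem_submodel hQ hgH hQg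
  have hdom : ∀ n y, ZFSet.pair n y ∈ x → n ∈ Subtype.val '' (S : Set (hereditarySets θ)) := by
    intro n
    induction n using ZFSet.inductionOn with
    | _ n ih =>
      intro y hy
      rcases h2 n y hy with rfl | ⟨m, z, hm, rfl⟩
      · exact empty_mem_submodel hθ hθ₀
      · exact insert_self_mem_submodel hθ hθ₀ (ih m (ZFSet.mem_insert _ _) z hm)
  obtain ⟨n, y, hn, rfl⟩ := h1 w hw
  -- Some value at `n` lies in the submodel, as `x` and `n` do; values are unique, so it is the
  -- given element.
  obtain ⟨z, hz, m, z', hp, rfl, rfl⟩ := exists_mem_submodel (S := S)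
    (Q := fun z => ∃ m z', ZFSet.pair m z' ∈ x ∧ m = n ∧ z' = z)
    (DefPred.exists_pair (DefPred.const hx)
      ((DefPred.eq (DefPred.var 0) (DefPred.const (hdom n y hn))).and
        (DefPred.eq (DefPred.var 1) (DefPred.var 2))))
    (hereditarySets_trans (hereditary_of_mem_submodel ha) hw) ⟨n, y, hn, rfl, rfl⟩
  exact h3 _ _ hp _ _ hn rfl ▸ hz

end ElementarySubmodels

end

section

open FirstOrder FirstOrder.Language

/-! ### Coding by sets -/

theorem ordSet_mem_ordSet {ξ η : OmegaOne} : ordSet ξ ∈ ordSet η ↔ ξ < η := by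
  simp [ordSet, Ordinal.toZFSet_mem_toZFSet_iff]

theorem ordSet_injective : Function.Injective ordSet := fun _ _ h =>
  Ordinal.ToType.mk.symm.injective (Subtype.ext (Ordinal.toZFSet_injective h))

theorem mem_imageSet {α : Type} {c : α → ZFSet.{0}} {s : Set α} {x : ZFSet.{0}} :
    x ∈ imageSet c s ↔ ∃ a ∈ s, c a = x := by
  simp [imageSet]

theorem mem_imageSet_iff {α : Type} {c : α → ZFSet.{0}} (hc : Function.Injective c) {s : Set α}
    {a : α} : c a ∈ imageSet c s ↔ a ∈ s := by
  simp [mem_imageSet, hc.eq_iff]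

theorem imageSet_injective {α : Type} {c : α → ZFSet.{0}} (hc : Function.Injective c) :
    Function.Injective (imageSet c) := fun s t h => by
  ext a
  rw [← mem_imageSet_iff hc, h, mem_imageSet_iff hc]

theorem pair_mem_graphSet {α β : Type} {c : α → ZFSet.{0}} {d : β → ZFSet.{0}} {f : α → β}
    {x y : ZFSet.{0}} : ZFSet.pair x y ∈ graphSet c d f ↔ ∃ a, c a = x ∧ d (f a) = y := by
  simp [graphSet, ZFSet.pair_inj]

theorem realSet_injective : Function.Injective realSet := by
  have hinj : Function.Injective
      fun q : ℚ => ((Encodable.encode q : ℕ) : Ordinal.{0}).toZFSet := fun p q h => by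
    simpa using Ordinal.toZFSet_injective h
  intro r s h
  have h' := imageSet_injective hinj h
  refine eq_of_forall_lt_iff fun t => ?_
  constructor <;> intro ht <;> obtain ⟨q, hq, hq'⟩ := exists_rat_btwn ht
  · exact hq.trans ((Set.ext_iff.1 h' q).1 hq')
  · exact hq.trans ((Set.ext_iff.1 h' q).2 hq')

theorem finOrdSet_injective : Function.Injective finOrdSet := fun _ _ h =>
  Finset.coe_injective (imageSet_injective ordSet_injective h)

theorem finRealSet_injective : Function.Injective finRealSet := fun _ _ h =>
  Finset.coe_injective (imageSet_injective realSet_injective h)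

theorem forall_mem_finOrdSet {F : Finset OmegaOne} {P : ZFSet.{0} → Prop} :
    (∀ x ∈ finOrdSet F, P x) ↔ ∀ ξ ∈ F, P (ordSet ξ) := by
  simp [finOrdSet, mem_imageSet]

theorem exists_mem_finOrdSet {F : Finset OmegaOne} {P : ZFSet.{0} → Prop} :
    (∃ x ∈ finOrdSet F, P x) ↔ ∃ ξ ∈ F, P (ordSet ξ) := by
  simp [finOrdSet, mem_imageSet]

/-- `y` belongs to the value at `x` of the function with graph `g`. -/
def MemValue (g x y : ZFSet.{0}) : Prop := ∃ n v, ZFSet.pair n v ∈ g ∧ n = x ∧ y ∈ v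

/-- The value at `x` of the function with graph `g` belongs to `w`. -/
def ValueMem (g x w : ZFSet.{0}) : Prop := ∃ n v, ZFSet.pair n v ∈ g ∧ n = x ∧ v ∈ w

theorem memValue_graphSet {α β : Type} {c : α → ZFSet.{0}} (hc : Function.Injective c)
    {d : β → ZFSet.{0}} {f : α → β} {a : α} {y : ZFSet.{0}} :
    MemValue (graphSet c d f) (c a) y ↔ y ∈ d (f a) := by
  simp [MemValue, pair_mem_graphSet, hc.eq_iff]

theorem valueMem_graphSet {α β : Type} {c : α → ZFSet.{0}} (hc : Function.Injective c)
    {d : β → ZFSet.{0}} {f : α → β} {a : α} {w : ZFSet.{0}} :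
    ValueMem (graphSet c d f) (c a) w ↔ d (f a) ∈ w := by
  simp [ValueMem, pair_mem_graphSet, hc.eq_iff]

namespace DefPred

variable {θ : Cardinal.{0}} {A : Set (hereditarySets θ)}

theorem memValue {s t u : (ℕ → ZFSet.{0}) → ZFSet.{0}} (hs : DefTerm A s) (ht : DefTerm A t)
    (hu : DefTerm A u) : DefPred A fun v => MemValue (s v) (t v) (u v) :=
  exists_pair hs (P := fun n y v => n = t v ∧ u v ∈ y)
    ((eq (var 0) (ht.comp _)).and (mem (hu.comp _) (var 1)))

theorem valueMem {s t u : (ℕ → ZFSet.{0}) → ZFSet.{0}} (hs : DefTerm A s) (ht : DefTerm A t)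
    (hu : DefTerm A u) : DefPred A fun v => ValueMem (s v) (t v) (u v) :=
  exists_pair hs (P := fun n y v => n = t v ∧ y ∈ u v)
    ((eq (var 0) (ht.comp _)).and (mem (var 1) (hu.comp _)))

end DefPred

/-! ### Reflection at a guessed stage -/

theorem countable_ratBase : ratBase.Countable := by
  refine (countable_range fun I : Finset (ℚ × ℚ) =>
    {H : Finset ℝ | (H : Set ℝ) ⊆ ⋃ p ∈ I, Ioo (p.1 : ℝ) (p.2 : ℝ)}).mono ?_
  rintro W ⟨I, -, rfl⟩
  exact mem_range_self I

/-- The points of the neighbourhood given by the sets `V γ`, `γ ∈ G`, and the preimages under `f`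
of the members of `𝒮`. -/
def nbhd (V : OmegaOne → Set OmegaOne) (f : OmegaOne → Finset ℝ) (G : Finset OmegaOne)
    (𝒮 : Finset (Set (Finset ℝ))) : Set OmegaOne :=
  {ξ | (∀ γ ∈ G, ξ ∈ V γ) ∧ ∀ W ∈ 𝒮, f ξ ∈ W}

/-- `H` is a member of the guessed uncountable family outside the submodel, and `f`, `V` are the
objects in the submodel that extend the data below `α`. The last two clauses are the instances of
reflection from `H` to `B α` that the recursion needs. -/
theorem exists_generic_finset {B : OmegaOne → Set (Finset OmegaOne)}
    {U : OmegaOne → OmegaOne → Set OmegaOne} {φ : OmegaOne → OmegaOne → Finset ℝ} {α : OmegaOne}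
    (hα : α ∈ guessSet B U φ α) (hφ : (Iio α).PairwiseDisjoint (φ α)) :
    ∃ (H : Finset OmegaOne) (f : OmegaOne → Finset ℝ) (V : OmegaOne → Set OmegaOne),
      (∀ ξ < α, f ξ = φ α ξ) ∧ (∀ γ < α, V γ ∩ Iio α = U α γ ∩ Iio α) ∧ (∀ ξ ∈ H, α ≤ ξ) ∧
      (∀ ξ ∈ H, ∀ η < α, Disjoint (f ξ) (f η)) ∧
      (∀ G : Finset OmegaOne, ↑G ⊆ Iio α → ∀ 𝒮 : Finset (Set (Finset ℝ)), ↑𝒮 ⊆ ratBase →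
        ↑H ⊆ nbhd V f G 𝒮 → ∃ F ∈ B α, ↑F ⊆ nbhd V f G 𝒮) ∧
      ∀ β < α, ∀ G : Finset OmegaOne, ↑G ⊆ Iio α → ∀ 𝒮 : Finset (Set (Finset ℝ)), ↑𝒮 ⊆ ratBase →
        ∀ K : Finset OmegaOne, ↑K ⊆ Iio α →
        (∀ F ∈ B α, (∀ ξ ∈ F, β < ξ) → ∃ E ∈ B β, ↑E ⊆ nbhd V f G 𝒮 ∧
          ∀ γ ∈ E, (∀ x ∈ K, x ∈ V γ) ∧ ∀ x ∈ F, x ∈ V γ) →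
        ∃ E ∈ B β, ↑E ⊆ nbhd V f G 𝒮 ∧ ∀ γ ∈ E, (∀ x ∈ K, x ∈ V γ) ∧ ∀ x ∈ H, x ∈ V γ := by
  obtain ⟨-, hBα, hdisj, θ, M, ⟨hθ, hθ'⟩, ⟨hMc, S, rfl⟩, hord, hrat, hB, ⟨f, hfM, hf⟩,
    ⟨X, hX, hXM, hXB⟩, ⟨V, hVM, hV⟩⟩ := hα
  have hθ₀ : ℵ₀ < θ :=
    ((Cardinal.cantor _).trans (Cardinal.cantor _)).trans hθ'
  have hordM : ∀ {ξ}, ξ < α → ordSet ξ ∈ Subtype.val '' (S : Set (hereditarySets θ)) :=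
    fun {ξ} h => (Set.ext_iff.1 hord ξ).2 h
  have hratM : ∀ {W}, W ∈ ratBase →
      imageSet finRealSet W ∈ Subtype.val '' (S : Set (hereditarySets θ)) := fun {W} hW => by
    refine mem_submodel_of_mem_countable hθ hθ₀ hrat ?_ (mem_imageSet.2 ⟨W, hW, rfl⟩)
    exact (countable_ratBase.image (imageSet finRealSet)).mono fun x hx => mem_imageSet.1 hx
  have reflect : ∀ {Q : ZFSet.{0} → Prop},
      DefPred (S : Set (hereditarySets θ)) (fun v => Q (v 0)) → ∀ H ∈ X, Q (finOrdSet H) →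
      ∃ F ∈ B α, Q (finOrdSet F) := by
    intro Q hQ H hH hq
    obtain ⟨y, hy, hyX, hQy⟩ := exists_mem_submodel
      (Q := fun x => x ∈ imageSet finOrdSet X ∧ Q x)
      ((DefPred.mem (DefPred.var 0) (DefPred.const hXM)).and hQ)
      (hereditarySets_trans (hereditary_of_mem_submodel hXM) (mem_imageSet.2 ⟨H, hH, rfl⟩))
      ⟨mem_imageSet.2 ⟨H, hH, rfl⟩, hq⟩
    obtain ⟨F, hF, rfl⟩ := mem_imageSet.1 hyX
    exact ⟨F, hXB.subset ⟨hF, hy⟩, hQy⟩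
  -- The family is uncountable and the submodel countable.
  obtain ⟨H, hHX, hHM⟩ : ∃ H ∈ X, finOrdSet H ∉ Subtype.val '' (S : Set (hereditarySets θ)) := by
    by_contra! h
    exact hX ((hMc.preimage_of_injOn (f := finOrdSet) finOrdSet_injective.injOn).mono h)
  have hHα : ∀ ξ ∈ H, α ≤ ξ := by
    intro ξ hξ
    by_contra! hlt
    -- A point `ξ < α` of `H` would lie in some `F ∈ B α`. As `H ≠ F`, a second reflection gives
    -- another member of `B α` through `ξ`, against disjointness.
    obtain ⟨F, hF, hξF⟩ := reflect (Q := fun x => ordSet ξ ∈ x)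
      (DefPred.mem (DefPred.const (hordM hlt)) (DefPred.var 0)) H hHX
      ((mem_imageSet_iff ordSet_injective).2 hξ)
    have hFM : finOrdSet F ∈ Subtype.val '' (S : Set (hereditarySets θ)) := (hXB.superset hF).2
    obtain ⟨F', hF', hξF', hne⟩ := reflect (Q := fun x => ordSet ξ ∈ x ∧ x ≠ finOrdSet F)
      ((DefPred.mem (DefPred.const (hordM hlt)) (DefPred.var 0)).and
        (DefPred.eq (DefPred.var 0) (DefPred.const hFM)).not) H hHX
      ⟨(mem_imageSet_iff ordSet_injective).2 hξ, fun h => hHM (h ▸ hFM)⟩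
    have h1 : ξ ∈ F := (mem_imageSet_iff ordSet_injective).1 hξF
    have h2 : ξ ∈ F' := (mem_imageSet_iff ordSet_injective).1 hξF'
    exact Finset.disjoint_left.1 (hdisj hF' hF fun h => hne (h ▸ rfl)) h2 h1
  have hnb : ∀ {G : Finset OmegaOne}, ↑G ⊆ Iio α → ∀ {𝒮 : Finset (Set (Finset ℝ))},
      ↑𝒮 ⊆ ratBase → ∀ {t : (ℕ → ZFSet.{0}) → ZFSet.{0}},
      DefTerm (S : Set (hereditarySets θ)) t →
      DefPred (S : Set (hereditarySets θ)) fun v => ∀ x ∈ t v,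
        (∀ γ ∈ G, MemValue (graphSet ordSet (imageSet ordSet) V) (ordSet γ) x) ∧
        ∀ W ∈ 𝒮, ValueMem (graphSet ordSet finRealSet f) x (imageSet finRealSet W) := by
    intro G hG 𝒮 h𝒮 t ht
    refine DefPred.ball ht (.and ?_ ?_)
    · exact DefPred.finset_all G fun γ hγ => DefPred.memValue (DefPred.const hVM)
        (DefPred.const (hordM (hG hγ))) (DefPred.var 0)
    · exact DefPred.finset_all 𝒮 fun W hW => DefPred.valueMem (DefPred.const hfM)
        (DefPred.var 0) (DefPred.const (hratM (h𝒮 hW)))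
  have hnb' : ∀ {G : Finset OmegaOne} {𝒮 : Finset (Set (Finset ℝ))} {F : Finset OmegaOne},
      (∀ x ∈ finOrdSet F,
        (∀ γ ∈ G, MemValue (graphSet ordSet (imageSet ordSet) V) (ordSet γ) x) ∧
        ∀ W ∈ 𝒮, ValueMem (graphSet ordSet finRealSet f) x (imageSet finRealSet W)) ↔
      ↑F ⊆ nbhd V f G 𝒮 := by
    intro G 𝒮 F
    simp only [forall_mem_finOrdSet, memValue_graphSet ordSet_injective,
      valueMem_graphSet ordSet_injective, mem_imageSet_iff ordSet_injective,
      mem_imageSet_iff finRealSet_injective]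
    rfl
  refine ⟨H, f, V, hf, hV, hHα, ?_, ?_, ?_⟩
  · intro ξ hξ η hη
    by_contra hnd
    obtain ⟨r, hr, hr'⟩ := Finset.not_disjoint_iff.1 hnd
    have hne : ξ ≠ η := fun h => (hHα ξ hξ).not_gt (h ▸ hη)
    -- A common real of `f ξ` and `f η` reflects to one of `f ζ` and `f η` with `ζ < α` and `ζ ≠ η`,
    -- where the values are disjoint.
    obtain ⟨F, hF, hF'⟩ := reflect (Q := fun x => ∃ ζ ∈ x, ζ ≠ ordSet η ∧
        ∃ n v, ZFSet.pair n v ∈ graphSet ordSet finRealSet f ∧ n = ζ ∧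
          ∃ z ∈ v, MemValue (graphSet ordSet finRealSet f) (ordSet η) z)
      (DefPred.bex (DefPred.var 0) ((DefPred.eq (DefPred.var 0) (DefPred.const (hordM hη))).not.and
        (DefPred.exists_pair (DefPred.const hfM) ((DefPred.eq (DefPred.var 0) (DefPred.var 2)).and
          (DefPred.bex (DefPred.var 1) (DefPred.memValue (DefPred.const hfM)
            (DefPred.const (hordM hη)) (DefPred.var 0))))))) H hHX
      (exists_mem_finOrdSet.2 ⟨ξ, hξ, fun h => hne (ordSet_injective h), ordSet ξ,
        finRealSet (f ξ), pair_mem_graphSet.2 ⟨ξ, rfl, rfl⟩, rfl, realSet r,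
        (mem_imageSet_iff realSet_injective).2 hr,
        (memValue_graphSet ordSet_injective).2 ((mem_imageSet_iff realSet_injective).2 hr')⟩)
    obtain ⟨ζ, hζ, hζη, _, _, hp, rfl, z, hz, hz'⟩ := exists_mem_finOrdSet.1 hF'
    obtain ⟨a, ha, rfl⟩ := pair_mem_graphSet.1 hp
    obtain rfl := ordSet_injective ha
    obtain ⟨r, hr, rfl⟩ := mem_imageSet.1 hz
    have hr' := (mem_imageSet_iff realSet_injective).1 ((memValue_graphSet ordSet_injective).1 hz')
    have haα : a < α := hBα F hF hζ
    have := hφ haα hη fun h => hζη (h ▸ rfl)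
    simp only [Function.onFun, ← hf a haα, ← hf η hη] at this
    exact Finset.disjoint_left.1 this hr hr'
  · intro G hG 𝒮 h𝒮 hH
    obtain ⟨F, hF, hQ⟩ := reflect (Q := fun y => ∀ x ∈ y,
      (∀ γ ∈ G, MemValue (graphSet ordSet (imageSet ordSet) V) (ordSet γ) x) ∧
      ∀ W ∈ 𝒮, ValueMem (graphSet ordSet finRealSet f) x (imageSet finRealSet W)) (hnb hG h𝒮 (DefPred.var 0)) H hHX (hnb'.2 hH)
    exact ⟨F, hF, hnb'.1 hQ⟩
  · intro β hβ G hG 𝒮 h𝒮 K hK hyp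
    let Q : ZFSet.{0} → Prop := fun x =>
      ∃ n b, ZFSet.pair n b ∈ graphSet ordSet (imageSet finOrdSet) B ∧ n = ordSet β ∧ ∃ e ∈ b,
        (∀ x ∈ e, (∀ γ ∈ G, MemValue (graphSet ordSet (imageSet ordSet) V) (ordSet γ) x) ∧
          ∀ W ∈ 𝒮, ValueMem (graphSet ordSet finRealSet f) x (imageSet finRealSet W)) ∧
        ∀ γ ∈ e, (∀ y ∈ K, MemValue (graphSet ordSet (imageSet ordSet) V) γ (ordSet y)) ∧
          ∀ y ∈ x, MemValue (graphSet ordSet (imageSet ordSet) V) γ y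
    have hQ : DefPred (S : Set (hereditarySets θ)) fun v => Q (v 0) := by
      refine DefPred.exists_pair (DefPred.const hB)
        ((DefPred.eq (DefPred.var 0) (DefPred.const (hordM hβ))).and (DefPred.bex (DefPred.var 1)
          ((hnb hG h𝒮 (DefPred.var 0)).and (DefPred.ball (DefPred.var 0) (.and ?_ ?_)))))
      · exact DefPred.finset_all K fun y hy => DefPred.memValue (DefPred.const hVM)
          (DefPred.var 0) (DefPred.const (hordM (hK hy)))
      · exact DefPred.ball (DefPred.var 4) (DefPred.memValue (DefPred.const hVM) (DefPred.var 1)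
          (DefPred.var 0))
    have hQ' : ∀ F : Finset OmegaOne, Q (finOrdSet F) ↔ ∃ E ∈ B β, ↑E ⊆ nbhd V f G 𝒮 ∧
        ∀ γ ∈ E, (∀ x ∈ K, x ∈ V γ) ∧ ∀ x ∈ F, x ∈ V γ := by
      intro F
      have hval : ∀ γ y, MemValue (graphSet ordSet (imageSet ordSet) V) (ordSet γ) (ordSet y) ↔
          y ∈ V γ := fun γ y => by
        rw [memValue_graphSet ordSet_injective, mem_imageSet_iff ordSet_injective]
      constructor
      · rintro ⟨_, _, hp, rfl, e, he, h1, h2⟩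
        obtain ⟨a, ha, rfl⟩ := pair_mem_graphSet.1 hp
        obtain rfl := ordSet_injective ha
        obtain ⟨E, hE, rfl⟩ := mem_imageSet.1 he
        refine ⟨E, hE, hnb'.1 h1, ?_⟩
        simpa only [forall_mem_finOrdSet, hval] using h2
      · rintro ⟨E, hE, h1, h2⟩
        refine ⟨_, _, pair_mem_graphSet.2 ⟨β, rfl, rfl⟩, rfl, finOrdSet E,
          mem_imageSet.2 ⟨E, hE, rfl⟩, hnb'.2 h1, ?_⟩
        simpa only [forall_mem_finOrdSet, hval] using h2
    -- If `Q` failed for `H`, which lies above `β`, it would fail for a member of `B α` above `β`.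
    by_contra hcon
    obtain ⟨F, hF, hFβ, hFQ⟩ := reflect (Q := fun x => (∀ ξ ∈ x, ordSet β ∈ ξ) ∧ ¬ Q x)
      ((DefPred.ball (DefPred.var 0) (DefPred.mem (DefPred.const (hordM hβ)) (DefPred.var 0))).and
        hQ.not) H hHX
      ⟨forall_mem_finOrdSet.2 fun ξ hξ => ordSet_mem_ordSet.2 (hβ.trans_le (hHα ξ hξ)),
        fun h => hcon ((hQ' H).1 h)⟩
    exact hFQ ((hQ' F).2 (hyp F hF fun ξ hξ => ordSet_mem_ordSet.1 (forall_mem_finOrdSet.1 hFβ ξ hξ)))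

end

/-! ### Existence of a construction -/

/-- Transfinite recursion with choice. The partial function is extended by the junk value `x₀`,
which is harmless because `P α` sees only values up to `α`. -/
theorem exists_forall_of_step {X : Type*} [Nonempty X] (P : OmegaOne → (OmegaOne → X) → Prop)
    (hloc : ∀ α f g, (∀ ξ ≤ α, f ξ = g ξ) → P α f → P α g)
    (step : ∀ α f, (∀ ξ < α, P ξ f) → ∃ x, P α (Function.update f α x)) : ∃ f, ∀ α, P α f := by
  classical
  obtain ⟨x₀⟩ := ‹Nonempty X›
  let ext : (α : OmegaOne) → ((ξ : OmegaOne) → ξ < α → X) → OmegaOne → X :=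
    fun α ih ξ => if h : ξ < α then ih ξ h else x₀
  let F : (α : OmegaOne) → ((ξ : OmegaOne) → ξ < α → X) → X := fun α ih =>
    Classical.epsilon (h := ⟨x₀⟩) fun x => P α (Function.update (ext α ih) α x)
  let f : OmegaOne → X := wellFounded_lt.fix F
  have hf : ∀ α, f α = F α fun ξ _ => f ξ := fun α => wellFounded_lt.fix_eq F α
  refine ⟨f, fun α => ?_⟩
  induction α using WellFoundedLT.induction with
  | ind α ih =>
    have hext : ∀ ξ < α, ext α (fun ξ _ => f ξ) ξ = f ξ := fun ξ hξ => dif_pos hξ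
    have h := Classical.epsilon_spec (step α (ext α fun ξ _ => f ξ) fun ξ hξ =>
      hloc ξ f _ (fun η hη => (hext η (hη.trans_lt hξ)).symm) (ih ξ hξ))
    refine hloc α _ f (fun ξ hξ => ?_) h
    rcases hξ.eq_or_lt with rfl | hlt
    · rw [Function.update_self, hf]
    · rw [Function.update_of_ne hlt.ne, hext ξ hlt]

theorem mem_guessSet_congr {B : OmegaOne → Set (Finset OmegaOne)}
    {U U' : OmegaOne → OmegaOne → Set OmegaOne} {φ φ' : OmegaOne → OmegaOne → Finset ℝ}
    {β : OmegaOne} (hU : ∀ γ < β, U β γ ∩ Iio β = U' β γ ∩ Iio β)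
    (hφ : ∀ ξ < β, φ β ξ = φ' β ξ) (h : β ∈ guessSet B U φ β) : β ∈ guessSet B U' φ' β := by
  obtain ⟨h1, h2, h3, θ, M, h4, h5, h6, h7, h8, ⟨f, hf, hf'⟩, h9, V, hV, hV'⟩ := h
  exact ⟨h1, h2, h3, θ, M, h4, h5, h6, h7, h8, ⟨f, hf, fun ξ hξ => (hf' ξ hξ).trans (hφ ξ hξ)⟩,
    h9, V, hV, fun γ hγ => (hV' γ hγ).trans (hU γ hγ)⟩

/-- If the members of a subbase contain basic neighbourhoods of their points, so do all open
sets. -/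
theorem exists_nbhd_subset_of_generateFrom {X : Type*} (e : X → OmegaOne)
    {V : OmegaOne → Set OmegaOne} {f : OmegaOne → Finset ℝ} {𝒜 : Set (Set X)}
    (h𝒜 : ∀ s ∈ 𝒜, ∀ x ∈ s, ∃ (G : Finset OmegaOne) (𝒮 : Finset (Set (Finset ℝ))),
      ↑𝒮 ⊆ ratBase ∧ e x ∈ nbhd V f G 𝒮 ∧ ∀ y, e y ∈ nbhd V f G 𝒮 → y ∈ s)
    {O : Set X} (hO : IsOpen[TopologicalSpace.generateFrom 𝒜] O) {x : X} (hx : x ∈ O) :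
    ∃ (G : Finset OmegaOne) (𝒮 : Finset (Set (Finset ℝ))),
      ↑𝒮 ⊆ ratBase ∧ e x ∈ nbhd V f G 𝒮 ∧ ∀ y, e y ∈ nbhd V f G 𝒮 → y ∈ O := by
  classical
  induction hO with
  | basic s hs => exact h𝒜 s hs x hx
  | univ => exact ⟨∅, ∅, by simp, by simp [nbhd], fun _ _ => trivial⟩
  | inter s t _ _ hs ht =>
    obtain ⟨G, 𝒮, h1, h2, h3⟩ := hs hx.1
    obtain ⟨G', 𝒮', h1', h2', h3'⟩ := ht hx.2
    refine ⟨G ∪ G', 𝒮 ∪ 𝒮', by rw [Finset.coe_union]; exact union_subset h1 h1', ⟨fun γ hγ => ?_,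
      fun W hW => ?_⟩, fun y hy => ⟨h3 y ?_, h3' y ?_⟩⟩
    · exact (Finset.mem_union.1 hγ).elim (h2.1 γ) (h2'.1 γ)
    · exact (Finset.mem_union.1 hW).elim (h2.2 W) (h2'.2 W)
    · exact ⟨fun γ hγ => hy.1 γ (Finset.mem_union_left _ hγ),
        fun W hW => hy.2 W (Finset.mem_union_left _ hW)⟩
    · exact ⟨fun γ hγ => hy.1 γ (Finset.mem_union_right _ hγ),
        fun W hW => hy.2 W (Finset.mem_union_right _ hW)⟩
  | sUnion T _ ih =>
    obtain ⟨t, ht, hxt⟩ := hx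
    obtain ⟨G, 𝒮, h1, h2, h3⟩ := ih t ht hxt
    exact ⟨G, 𝒮, h1, h2, fun y hy => ⟨t, ht, h3 y hy⟩⟩

/-- The data of a construction, given at each point `ξ` by the set of those `γ < ξ` for which `ξ`
is put into `U_γ`, and by the finite set `φ(ξ)`. -/
abbrev PointData : Type := OmegaOne → Set OmegaOne × Finset ℝ

/-! ### The recursion: coherent data and the choice of a new point -/

namespace PointData

/-- The set `U_γ` obtained from the data `g`. -/
def sets (g : PointData) (γ : OmegaOne) : Set OmegaOne := {ξ | ξ ≤ γ ∨ γ ∈ (g ξ).1}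

/-- The map `φ` obtained from the data `g`. -/
def map (g : PointData) (ξ : OmegaOne) : Finset ℝ := (g ξ).2

/-- The sets `U^α_γ` obtained from the data `g`. -/
def stageSets (g : PointData) (α γ : OmegaOne) : Set OmegaOne := sets g γ ∩ Iic α

/-- The maps `φ_α` obtained from the data `g`. -/
def stageMap (g : PointData) (_α ξ : OmegaOne) : Finset ℝ := map g ξ

/-- The set of stages at which the data `g` are guessed. -/
def guessed (B : OmegaOne → Set (Finset OmegaOne)) (g : PointData) : Set OmegaOne :=
  {α | α ∈ guessSet B (stageSets g) (stageMap g) α}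

/-- `C α` is closed discrete in the topology on `α`, in terms of basic neighbourhoods. -/
def SmallNbhds (C : OmegaOne → Set OmegaOne) (g : PointData) (α : OmegaOne) : Prop :=
  ∀ β < α, ∃ (G : Finset OmegaOne) (𝒮 : Finset (Set (Finset ℝ))), ↑𝒮 ⊆ ratBase ∧
    β ∈ nbhd (sets g) (map g) G 𝒮 ∧ nbhd (sets g) (map g) G 𝒮 ∩ C α ⊆ {β}

/-- The requirements on the data `g` at the stage `α`. -/
structure Good (C : OmegaOne → Set OmegaOne) (B : OmegaOne → Set (Finset OmegaOne))
    (α : OmegaOne) (g : PointData) : Prop where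
  nonempty : (map g α).Nonempty
  disjoint : ∀ ξ < α, Disjoint (map g ξ) (map g α)
  not_mem : SmallNbhds C g α → ∀ γ ∈ C α, α ∉ sets g γ
  network : α ∈ guessed B g → ∀ (G : Finset OmegaOne) (𝒮 : Finset (Set (Finset ℝ))),
    ↑𝒮 ⊆ ratBase → α ∈ nbhd (sets g) (map g) G 𝒮 → ∃ F ∈ B α, ↑F ⊆ nbhd (sets g) (map g) G 𝒮
  cover : ∀ β < α, β ∈ guessed B g → ∀ (G : Finset OmegaOne) (𝒮 : Finset (Set (Finset ℝ))),
    ↑𝒮 ⊆ ratBase → β ∈ nbhd (sets g) (map g) G 𝒮 → ∀ K : Finset OmegaOne, ↑K ⊆ Ioc β α →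
    ∃ F ∈ B β, ↑F ⊆ nbhd (sets g) (map g) G 𝒮 ∧ ∀ γ ∈ F, ∀ x ∈ K, x ∈ sets g γ

variable {C : OmegaOne → Set OmegaOne} {B : OmegaOne → Set (Finset OmegaOne)} {f g : PointData}
  {α : OmegaOne}

theorem mem_sets_congr {ξ γ : OmegaOne} (h : f ξ = g ξ) : ξ ∈ sets f γ ↔ ξ ∈ sets g γ := by
  simp [sets, h]

theorem mem_nbhd_congr {ξ : OmegaOne} (h : f ξ = g ξ) {G : Finset OmegaOne}
    {𝒮 : Finset (Set (Finset ℝ))} :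
    ξ ∈ nbhd (sets f) (map f) G 𝒮 ↔ ξ ∈ nbhd (sets g) (map g) G 𝒮 := by
  simp [nbhd, sets, map, h]

theorem guessed_congr (h : ∀ ξ < α, f ξ = g ξ) (hα : α ∈ guessed B f) : α ∈ guessed B g := by
  refine mem_guessSet_congr (fun γ _ => ?_) (fun ξ hξ => ?_) hα
  · ext ξ
    simp only [stageSets, mem_inter_iff, mem_Iio]
    refine and_congr_left fun hξ => ?_
    rw [mem_sets_congr (h ξ hξ)]
  · simp [stageMap, map, h ξ hξ]

theorem subset_Iio_of_guessed (hα : α ∈ guessed B g) {F : Finset OmegaOne} (hF : F ∈ B α) :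
    (F : Set OmegaOne) ⊆ Iio α :=
  hα.2.1 F hF

theorem SmallNbhds.congr (hC : C α ⊆ Iio α) (h : ∀ ξ < α, f ξ = g ξ) (hf : SmallNbhds C f α) :
    SmallNbhds C g α := by
  intro β hβ
  obtain ⟨G, 𝒮, h𝒮, h1, h2⟩ := hf β hβ
  exact ⟨G, 𝒮, h𝒮, (mem_nbhd_congr (h β hβ)).1 h1,
    fun ξ hξ => h2 ⟨(mem_nbhd_congr (h ξ (hC hξ.2))).2 hξ.1, hξ.2⟩⟩

theorem Good.congr (hC : C α ⊆ Iio α) (h : ∀ ξ ≤ α, f ξ = g ξ) (hf : Good C B α f) :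
    Good C B α g := by
  have h' : ∀ ξ < α, f ξ = g ξ := fun ξ hξ => h ξ hξ.le
  have hs : ∀ ξ < α, g ξ = f ξ := fun ξ hξ => (h ξ hξ.le).symm
  have hm : ∀ ξ ≤ α, map f ξ = map g ξ := fun ξ hξ => by simp [map, h ξ hξ]
  refine ⟨hm α le_rfl ▸ hf.nonempty, fun ξ hξ => ?_, fun hsm γ hγ hα => ?_, ?_, ?_⟩
  · rw [← hm ξ hξ.le, ← hm α le_rfl]
    exact hf.disjoint ξ hξ
  · exact hf.not_mem (hsm.congr hC hs) γ hγ ((mem_sets_congr (h α le_rfl)).2 hα)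
  · intro hα G 𝒮 h𝒮 hn
    obtain ⟨F, hF, hF'⟩ := hf.network (guessed_congr hs hα) G 𝒮 h𝒮
      ((mem_nbhd_congr (h α le_rfl)).2 hn)
    exact ⟨F, hF, fun ξ hξ =>
      (mem_nbhd_congr (h' ξ (subset_Iio_of_guessed hα hF hξ))).1 (hF' hξ)⟩
  · intro β hβ hβg G 𝒮 h𝒮 hn K hK
    obtain ⟨F, hF, hF', hFK⟩ := hf.cover β hβ (guessed_congr (fun ξ hξ => hs ξ (hξ.trans hβ)) hβg)
      G 𝒮 h𝒮 ((mem_nbhd_congr (h' β hβ)).2 hn) K hK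
    exact ⟨F, hF, fun ξ hξ =>
      (mem_nbhd_congr (h' ξ ((subset_Iio_of_guessed hβg hF hξ).trans hβ))).1 (hF' hξ),
      fun γ hγ x hx => (mem_sets_congr (h x (hK hx).2)).1 (hFK γ hγ x hx)⟩

/-- The covering clause at stage `max K` handles all of `K`; for empty `K` the network clause at `β`
supplies the set. -/
theorem exists_cover_of_good (hf : ∀ ξ < α, Good C B ξ f) {β : OmegaOne} (hβ : β < α)
    (hβg : β ∈ guessed B f) {G : Finset OmegaOne} {𝒮 : Finset (Set (Finset ℝ))}
    (h𝒮 : ↑𝒮 ⊆ ratBase) (hn : β ∈ nbhd (sets f) (map f) G 𝒮) {K : Finset OmegaOne}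
    (hK : ↑K ⊆ Ioo β α) :
    ∃ F ∈ B β, ↑F ⊆ nbhd (sets f) (map f) G 𝒮 ∧ ∀ γ ∈ F, ∀ x ∈ K, x ∈ sets f γ := by
  rcases K.eq_empty_or_nonempty with rfl | hne
  · obtain ⟨F, hF, hF'⟩ := (hf β hβ).network hβg G 𝒮 h𝒮 hn
    exact ⟨F, hF, hF', by simp⟩
  · have hm := hK (K.max'_mem hne)
    exact (hf _ hm.2).cover β hm.1 hβg G 𝒮 h𝒮 hn K fun x hx => ⟨(hK hx).1, K.le_max' x hx⟩

/-- A finite set `H` above `α`, with a map `h` and sets `V γ` that extend the data below `α`, such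
that the values of `h` on `H` are suitable for the value of the map at `α`, and the `γ` with
`H ⊆ V γ` are suitable for the sets that contain `α`. -/
theorem exists_guide (hf : ∀ ξ < α, Good C B ξ f) :
    ∃ (H : Finset OmegaOne) (h : OmegaOne → Finset ℝ) (V : OmegaOne → Set OmegaOne),
      (∀ ξ < α, h ξ = map f ξ) ∧ (∀ γ < α, ∀ ξ < α, ξ ∈ V γ ↔ ξ ∈ sets f γ) ∧
      (∀ ξ ∈ H, ∀ η < α, Disjoint (h ξ) (h η)) ∧
      (α ∈ guessed B f → ∀ G : Finset OmegaOne, ↑G ⊆ Iio α → ∀ 𝒮 : Finset (Set (Finset ℝ)),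
        ↑𝒮 ⊆ ratBase → ↑H ⊆ nbhd V h G 𝒮 → ∃ F ∈ B α, ↑F ⊆ nbhd V h G 𝒮) ∧
      ∀ β < α, β ∈ guessed B f → ∀ G : Finset OmegaOne, ↑G ⊆ Iio α →
        ∀ 𝒮 : Finset (Set (Finset ℝ)), ↑𝒮 ⊆ ratBase → β ∈ nbhd V h G 𝒮 →
        ∀ K : Finset OmegaOne, ↑K ⊆ Ioo β α →
        ∃ E ∈ B β, ↑E ⊆ nbhd V h G 𝒮 ∧ ∀ γ ∈ E, (∀ x ∈ K, x ∈ V γ) ∧ ∀ x ∈ H, x ∈ V γ := by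
  classical
  by_cases hα : α ∈ guessed B f
  · have hdisj : (Iio α).PairwiseDisjoint (stageMap f α) := by
      intro ξ hξ η hη hne
      rcases lt_or_gt_of_ne hne with h | h
      · exact (hf η hη).disjoint ξ h
      · exact ((hf ξ hξ).disjoint η h).symm
    obtain ⟨H, h, V, hh, hV, hH, hd, h3, h4⟩ := exists_generic_finset hα hdisj
    have hV' : ∀ γ < α, ∀ ξ < α, ξ ∈ V γ ↔ ξ ∈ sets f γ := fun γ hγ ξ hξ => by
      have := Set.ext_iff.1 (hV γ hγ) ξ
      simpa [stageSets, hξ, hξ.le] using this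
    have hn : ∀ {G : Finset OmegaOne}, ↑G ⊆ Iio α → ∀ {𝒮 : Finset (Set (Finset ℝ))}, ∀ ξ < α,
        ξ ∈ nbhd V h G 𝒮 ↔ ξ ∈ nbhd (sets f) (map f) G 𝒮 := fun {G} hG {𝒮} ξ hξ => by
      refine and_congr (forall₂_congr fun γ hγ => hV' γ (hG hγ) ξ hξ) ?_
      rw [hh ξ hξ]
      rfl
    refine ⟨H, h, V, hh, hV', hd, fun _ => h3, ?_⟩
    intro β hβ hβg G hG 𝒮 h𝒮 hβn K hK
    refine h4 β hβ G hG 𝒮 h𝒮 K (fun x hx => (hK hx).2) fun F hF hFβ => ?_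
    have hFα := subset_Iio_of_guessed hα hF
    -- Each `F ∈ B α` above `β` lies in the interval from `β` to `α`, so earlier stages cover `K ∪
    -- F`; elementarity then replaces `F` by `H`.
    obtain ⟨E, hE, hE1, hE2⟩ := exists_cover_of_good hf hβ hβg h𝒮 ((hn hG β hβ).1 hβn)
      (K := K ∪ F) (by
        intro x hx
        rcases Finset.mem_union.1 hx with hx | hx
        exacts [hK hx, ⟨hFβ x hx, hFα hx⟩])
    have hEα : ∀ γ ∈ E, γ < α := fun γ hγ => (subset_Iio_of_guessed hβg hE hγ).trans hβ
    refine ⟨E, hE, fun ξ hξ => (hn hG ξ (hEα ξ hξ)).2 (hE1 hξ), fun γ hγ => ⟨fun x hx => ?_,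
      fun x hx => ?_⟩⟩
    · exact (hV' γ (hEα γ hγ) x (hK hx).2).2 (hE2 γ hγ x (Finset.mem_union_left _ hx))
    · exact (hV' γ (hEα γ hγ) x (hFα hx)).2 (hE2 γ hγ x (Finset.mem_union_right _ hx))
  -- With no guess at `α` there is nothing to imitate, and `H` is empty.
  · refine ⟨∅, map f, sets f, fun _ _ => rfl, fun _ _ _ _ => Iff.rfl, by simp,
      fun h => absurd h hα, ?_⟩
    intro β hβ hβg G _ 𝒮 h𝒮 hβn K hK
    obtain ⟨E, hE, hE1, hE2⟩ := exists_cover_of_good hf hβ hβg h𝒮 hβn hK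
    exact ⟨E, hE, hE1, fun γ hγ => ⟨hE2 γ hγ, by simp⟩⟩

theorem mem_of_subset_of_mem_ratBase {W : Set (Finset ℝ)} (hW : W ∈ ratBase) {p q : Finset ℝ}
    (hpq : p ⊆ q) (hq : q ∈ W) : p ∈ W := by
  obtain ⟨I, -, rfl⟩ := hW
  exact (Finset.coe_subset.2 hpq).trans hq

/-- The point `α` imitates the finite set `H`: each basic condition that holds at `α` must hold on
all of `H`. -/
theorem exists_good_update (hC : C α ⊆ Iio α) (hf : ∀ ξ < α, Good C B ξ f) :
    ∃ x, Good C B α (Function.update f α x) := by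
  classical
  obtain ⟨H, h, V, hh, hV, hd, h3, h4⟩ := exists_guide hf
  obtain ⟨r, hr⟩ : ∃ r, r ∉ ⋃ ξ ∈ Iio α, (map f ξ : Set ℝ) := by
    by_contra! hall
    refine Cardinal.not_countable_real (((countable_Iio α).biUnion fun ξ _ =>
      (map f ξ).countable_toSet).mono fun r _ => hall r)
  have hr' : ∀ ξ < α, r ∉ map f ξ := fun ξ hξ hrξ => hr (mem_biUnion hξ hrξ)
  -- The fresh real `r` makes the value non-empty even if `H` is empty. Members of `ratBase` are
  -- closed under subsets, so `p ∈ W` gives `h x ∈ W` for all `x ∈ H`.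
  let p : Finset ℝ := insert r (H.biUnion h)
  let Γ : Set OmegaOne :=
    {γ | γ < α ∧ (SmallNbhds C f α → γ ∉ C α) ∧ ∀ x ∈ H, x ∈ V γ}
  let g : PointData := Function.update f α (Γ, p)
  have hgα : g α = (Γ, p) := Function.update_self ..
  have hfg : ∀ ξ < α, f ξ = g ξ := fun ξ hξ => (Function.update_of_ne hξ.ne ..).symm
  have hgf : ∀ ξ < α, g ξ = f ξ := fun ξ hξ => (hfg ξ hξ).symm
  have hmapα : map g α = p := by simp [map, hgα]
  have hmap : ∀ ξ < α, map g ξ = map f ξ := fun ξ hξ => by simp [map, hfg ξ hξ]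
  have hα_mem : ∀ γ < α, α ∈ sets g γ ↔ γ ∈ Γ := fun γ hγ => by
    simp [sets, hgα, hγ.not_ge]
  have hVg : ∀ γ < α, ∀ ξ < α, ξ ∈ V γ ↔ ξ ∈ sets g γ := fun γ hγ ξ hξ =>
    (hV γ hγ ξ hξ).trans (mem_sets_congr (hfg ξ hξ))
  -- Indices `γ ≥ δ` impose nothing on points below `δ`, as `sets g γ` contains all points up to
  -- `γ`.
  have hnb : ∀ {G : Finset OmegaOne} {𝒮 : Finset (Set (Finset ℝ))} {ξ δ : OmegaOne}, ξ < δ →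
      δ ≤ α → ξ ∈ nbhd V h (G.filter (· < δ)) 𝒮 → ξ ∈ nbhd (sets g) (map g) G 𝒮 := by
    intro G 𝒮 ξ δ hξ hδ hn
    refine ⟨fun γ hγ => ?_, fun W hW => ?_⟩
    · by_cases hγδ : γ < δ
      · exact (hVg γ (hγδ.trans_le hδ) ξ (hξ.trans_le hδ)).1
          (hn.1 γ (Finset.mem_filter.2 ⟨hγ, hγδ⟩))
      · exact .inl (hξ.le.trans (not_lt.1 hγδ))
    · rw [hmap ξ (hξ.trans_le hδ), ← hh ξ (hξ.trans_le hδ)]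
      exact hn.2 W hW
  refine ⟨(Γ, p), ?_, ?_, ?_, ?_, ?_⟩
  · change (map g α).Nonempty
    rw [hmapα]
    exact Finset.insert_nonempty _ _
  · intro ξ hξ
    change Disjoint (map g ξ) (map g α)
    rw [hmap ξ hξ, hmapα, Finset.disjoint_insert_right, Finset.disjoint_biUnion_right]
    exact ⟨hr' ξ hξ, fun x hx => hh ξ hξ ▸ (hd x hx ξ hξ).symm⟩
  · intro hsm γ hγ hα
    have hγα : γ < α := hC hγ
    exact (((hα_mem γ hγα).1 hα).2.1 (SmallNbhds.congr hC hgf hsm)) hγ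
  · intro hα G 𝒮 h𝒮 hn
    have hα' : α ∈ guessed B f := guessed_congr hgf hα
    obtain ⟨F, hF, hF'⟩ := h3 hα' (G.filter (· < α))
      (fun γ hγ => (Finset.mem_filter.1 hγ).2) 𝒮 h𝒮 (by
        refine fun x hx => ⟨fun γ hγ => ?_, fun W hW => ?_⟩
        · have hγ' := Finset.mem_filter.1 hγ
          exact ((hα_mem γ hγ'.2).1 (hn.1 γ hγ'.1)).2.2 x hx
        · refine mem_of_subset_of_mem_ratBase (h𝒮 hW) ?_ (hmapα ▸ hn.2 W hW)
          exact (Finset.subset_biUnion_of_mem h hx).trans (Finset.subset_insert _ _))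
    exact ⟨F, hF, fun ξ hξ => hnb (subset_Iio_of_guessed hα hF hξ) le_rfl (hF' hξ)⟩
  · intro β hβ hβg G 𝒮 h𝒮 hn K hK
    have hβg' : β ∈ guessed B f := guessed_congr (fun ξ hξ => hgf ξ (hξ.trans hβ)) hβg
    -- A second neighbourhood of `β` that avoids `C α` except possibly at `β`. Since `E` will lie
    -- below `β`, the exclusion of `C α` from `Γ` removes no index in `E`.
    obtain ⟨G₁, 𝒮₁, h𝒮₁, hn₁, hsub⟩ : ∃ (G₁ : Finset OmegaOne) (𝒮₁ : Finset (Set (Finset ℝ))),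
        ↑𝒮₁ ⊆ ratBase ∧ β ∈ nbhd (sets g) (map g) G₁ 𝒮₁ ∧
        (SmallNbhds C f α → nbhd (sets g) (map g) G₁ 𝒮₁ ∩ C α ⊆ {β}) := by
      by_cases hsm : SmallNbhds C f α
      · obtain ⟨G₁, 𝒮₁, h1, h2, h3⟩ := hsm.congr hC hfg β hβ
        exact ⟨G₁, 𝒮₁, h1, h2, fun _ => h3⟩
      · exact ⟨∅, ∅, by simp, by simp [nbhd], fun h => absurd h hsm⟩
    have hlt : ∀ {G : Finset OmegaOne}, ↑(G.filter (· < β)) ⊆ Iio α := fun {G} γ hγ =>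
      (Finset.mem_filter.1 hγ).2.trans hβ
    obtain ⟨E, hE, hE1, hE2⟩ := h4 β hβ hβg' ((G ∪ G₁).filter (· < β)) hlt (𝒮 ∪ 𝒮₁)
      (by rw [Finset.coe_union]; exact union_subset h𝒮 h𝒮₁)
      (by
        refine ⟨fun γ hγ => ?_, fun W hW => ?_⟩
        · refine (hVg γ (hlt hγ) β hβ).2 ?_
          rcases Finset.mem_union.1 (Finset.mem_filter.1 hγ).1 with hγ | hγ
          exacts [hn.1 γ hγ, hn₁.1 γ hγ]
        · rw [hh β hβ, ← hmap β hβ]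
          rcases Finset.mem_union.1 hW with hW | hW
          exacts [hn.2 W hW, hn₁.2 W hW]) (K.erase α)
      (fun x hx => by
        have hx' := Finset.mem_erase.1 hx
        exact ⟨(hK hx'.2).1, lt_of_le_of_ne (hK hx'.2).2 hx'.1⟩)
    have hEβ := subset_Iio_of_guessed hβg hE
    have hEn : ∀ ξ ∈ E, ξ ∈ nbhd (sets g) (map g) (G ∪ G₁) (𝒮 ∪ 𝒮₁) := fun ξ hξ =>
      hnb (hEβ hξ) hβ.le (hE1 hξ)
    refine ⟨E, hE, fun ξ hξ => ⟨fun γ hγ => (hEn ξ hξ).1 γ (Finset.mem_union_left _ hγ),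
      fun W hW => (hEn ξ hξ).2 W (Finset.mem_union_left _ hW)⟩, fun γ hγ x hx => ?_⟩
    have hγα : γ < α := (hEβ hγ).trans hβ
    rcases eq_or_ne x α with rfl | hne
    · refine (hα_mem γ hγα).2 ⟨hγα, fun hsm hγC => ?_, (hE2 γ hγ).2⟩
      have : γ = β := hsub hsm ⟨⟨fun δ hδ => (hEn γ hγ).1 δ (Finset.mem_union_right _ hδ),
        fun W hW => (hEn γ hγ).2 W (Finset.mem_union_right _ hW)⟩, hγC⟩
      exact (hEβ hγ).ne this
    · exact (hVg γ hγα x (lt_of_le_of_ne (hK hx).2 hne)).1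
        ((hE2 γ hγ).1 x (Finset.mem_erase.2 ⟨hne, hx⟩))

theorem exists_good (hC : ∀ α, C α ⊆ Iio α) : ∃ g : PointData, ∀ α, Good C B α g :=
  exists_forall_of_step (fun α g => Good C B α g) (fun α _ _ h hf => hf.congr (hC α) h)
    fun α _ hf => exists_good_update (hC α) hf

/-- Open sets of the topology `τ_α` contain basic neighbourhoods of their points. -/
theorem exists_nbhd_subset {O : Set (Iic α)}
    (hO : IsOpen[stageTopology (stageSets g) (stageMap g) α] O) {x : Iic α} (hx : x ∈ O) :
    ∃ (G : Finset OmegaOne) (𝒮 : Finset (Set (Finset ℝ))), ↑𝒮 ⊆ ratBase ∧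
      (x : OmegaOne) ∈ nbhd (sets g) (map g) G 𝒮 ∧
      ∀ y : Iic α, (y : OmegaOne) ∈ nbhd (sets g) (map g) G 𝒮 → y ∈ O := by
  refine exists_nbhd_subset_of_generateFrom Subtype.val ?_ hO hx
  rintro _ (⟨γ, -, rfl⟩ | ⟨W, hW, rfl⟩) x hx
  · exact ⟨{γ}, ∅, by simp, ⟨by simpa using hx.1, by simp⟩,
      fun y hy => ⟨hy.1 γ (Finset.mem_singleton_self γ), y.2⟩⟩
  · exact ⟨∅, {W}, by simpa using hW, ⟨by simp, by simpa [stageMap] using hx⟩,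
      fun y hy => hy.2 W (Finset.mem_singleton_self W)⟩

theorem exists_isOpen_inter_subset {X : Type*} [TopologicalSpace X] {D : Set X}
    (hD : IsClosedDiscrete D) (x : X) : ∃ O, IsOpen O ∧ x ∈ O ∧ O ∩ D ⊆ {x} := by
  by_cases hx : x ∈ D
  · have h := isDiscrete_iff_nhdsWithin.1 hD.2 x hx
    have h1 : {x} ∈ 𝓝[D] x := h ▸ Filter.mem_pure.2 rfl
    obtain ⟨O, hO, hxO, hsub⟩ := mem_nhdsWithin.1 h1
    exact ⟨O, hO, hxO, hsub⟩
  · exact ⟨Dᶜ, hD.1.isOpen_compl, hx, fun y hy => absurd hy.2 hy.1⟩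

theorem smallNbhds_of_isClosedDiscrete
    (h : @IsClosedDiscrete _ (stageTopology (stageSets g) (stageMap g) α)
      {ξ : Iic α | (ξ : OmegaOne) ∈ C α}) (hC : C α ⊆ Iio α) : SmallNbhds C g α := by
  intro β hβ
  obtain ⟨O, hO, hβO, hsub⟩ := @exists_isOpen_inter_subset _ (_) _ h ⟨β, hβ.le⟩
  obtain ⟨G, 𝒮, h1, h2, h3⟩ := exists_nbhd_subset hO hβO
  refine ⟨G, 𝒮, h1, h2, fun ξ hξ => ?_⟩
  have := hsub (a := ⟨ξ, mem_Iic.2 (mem_Iio.1 (hC hξ.2)).le⟩) ⟨h3 _ hξ.1, hξ.2⟩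
  exact congrArg Subtype.val this

theorem isConstruction_of_good (hC : ∀ α, C α ⊆ Iio α) (hg : ∀ α, Good C B α g) :
    IsConstruction C B (stageSets g) (stageMap g) where
  subset α γ _ := inter_subset_right
  self α := inter_eq_right.2 fun ξ hξ => .inl hξ
  disjoint α ξ _ η _ hne := by
    rcases lt_or_gt_of_ne hne with h | h
    · exact (hg η).disjoint ξ h
    · exact ((hg ξ).disjoint η h).symm
  coherent α α₀ hle γ _ := by
    rw [stageSets, stageSets, inter_assoc, inter_eq_right.2 (Iic_subset_Iic.2 hle)]
  coherent_map _ _ _ _ _ := rfl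
  not_cover α h heq := by
    have hα : α ∈ ⋃ γ ∈ C α, stageSets g α γ := heq ▸ mem_Iic.2 le_rfl
    obtain ⟨γ, hγ, hαγ⟩ := mem_iUnion₂.1 hα
    exact (hg α).not_mem (smallNbhds_of_isClosedDiscrete h (hC α)) γ hγ hαγ.1
  network α β hβ O hO hβO := by
    obtain ⟨G, 𝒮, h1, h2, h3⟩ := exists_nbhd_subset hO hβO
    have hβg : (β : OmegaOne) ∈ guessed B g := ⟨le_rfl, hβ.2⟩
    obtain ⟨F, hF, hFn⟩ := (hg β).network hβg G 𝒮 h1 h2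
    exact ⟨_, ⟨F, hF, rfl⟩, fun ξ hξ => h3 ξ (hFn hξ)⟩
  omega_cover α β hβ hlt O hO hβO K hK hKs := by
    obtain ⟨G, 𝒮, h1, h2, h3⟩ := exists_nbhd_subset hO hβO
    have hβg : (β : OmegaOne) ∈ guessed B g := ⟨le_rfl, hβ.2⟩
    obtain ⟨F, hF, hFn, hFK⟩ := (hg α).cover β hlt hβg G 𝒮 h1 h2 hK.toFinset (by simpa using hKs)
    refine ⟨_, ⟨F, hF, fun ξ hξ => ⟨⟨ξ, ((subset_Iio_of_guessed hβg hF hξ).trans hlt).le⟩,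
      h3 _ (hFn hξ), rfl⟩, rfl⟩, fun x hx => ⟨(hKs hx).2, fun γ hγ => ?_⟩⟩
    exact ⟨hFK γ hγ x (hK.mem_toFinset.2 hx), (hKs hx).2⟩

end PointData

theorem exists_isConstruction {C : OmegaOne → Set OmegaOne} (B : OmegaOne → Set (Finset OmegaOne))
    (hC : IsCountableSetEnumeration C) :
    ∃ (U : OmegaOne → OmegaOne → Set OmegaOne) (φ : OmegaOne → OmegaOne → Finset ℝ),
      IsConstruction C B U φ ∧ ∀ α, ∀ ξ ≤ α, (φ α ξ).Nonempty := by
  obtain ⟨g, hg⟩ := PointData.exists_good (B := B) hC.1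
  exact ⟨_, _, PointData.isConstruction_of_good hC.1 hg, fun _ ξ _ => (hg ξ).nonempty⟩

section

open FirstOrder FirstOrder.Language

/-! ### Elementary submodels with prescribed elements -/

/-- The transitive closure of `x` lies in a level of the cumulative hierarchy, hence is small. A
successor cardinal above its size and `2^{2^ω}` is regular and serves as `θ`. -/
theorem exists_isSufficientlyLarge (x : ZFSet.{0}) :
    ∃ θ, IsSufficientlyLarge θ ∧ x ∈ hereditarySets θ := by
  have hsmall : Small.{0} (transitiveClosure x) := by
    have : Small.{0} {y : ZFSet.{0} | y ∈ ZFSet.vonNeumann x.rank} := ZFSet.small_coe _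
    have hsub : transitiveClosure x ⊆ {y : ZFSet.{0} | y ∈ ZFSet.vonNeumann x.rank} := by
      intro y hy
      refine ZFSet.mem_vonNeumann.2 ?_
      induction hy using Relation.TransGen.head_induction_on with
      | single h => exact ZFSet.rank_lt_of_mem h
      | head h _ ih => exact (ZFSet.rank_lt_of_mem h).trans ih
    exact small_subset hsub
  let κ : Cardinal.{0} := #(Shrink.{0} (transitiveClosure x))
  let c : Cardinal.{0} := max κ (2 ^ (2 ^ ℵ₀ : Cardinal.{0}))
  have hc : ℵ₀ ≤ c :=
    ((Cardinal.cantor _).trans (Cardinal.cantor _)).le.trans (le_max_right _ _)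
  refine ⟨Order.succ c, ⟨Cardinal.isRegular_succ hc,
    (le_max_right _ _).trans_lt (Order.lt_succ c)⟩, ?_⟩
  have : #(transitiveClosure x) = Cardinal.lift.{1, 0} κ :=
    (Cardinal.lift_mk_shrink'' (transitiveClosure x)).symm
  change #(transitiveClosure x) < _
  rw [this, Cardinal.lift_lt]
  exact (le_max_left _ _).trans_lt (Order.lt_succ c)

theorem countable_skolem_functions :
    Countable (Σ l, (setLanguage.sum setLanguage.skolem₁).Functions l) := by
  have h1 : IsEmpty (Σ l, setLanguage.Functions l) :=
    ⟨fun f => Empty.elim f.2⟩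
  have h2 : Subsingleton (Σ l, setLanguage.Relations l) :=
    ⟨by rintro ⟨_, ⟨⟩⟩ ⟨_, ⟨⟩⟩; rfl⟩
  have h3 : Countable setLanguage.Symbols :=
    inferInstanceAs (Countable ((Σ l, setLanguage.Functions l) ⊕ (Σ l, setLanguage.Relations l)))
  refine Cardinal.mk_le_aleph0_iff.1 (card_functions_sum_skolem₁_le.trans (max_le le_rfl ?_))
  exact Cardinal.mk_le_aleph0_iff.2 h3

/-- The Skolem hulls `N β` of `P` and the codes below `β` form a continuous chain of countable
submodels. On a club of `β`, `N β` contains exactly the ordinals below `β`. -/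
theorem exists_submodel_of_stationary {θ : Cardinal.{0}} (P : Set (hereditarySets θ))
    (hP : P.Countable) (hord : ∀ ξ, ordSet ξ ∈ hereditarySets θ)
    (hfin : ∀ F, finOrdSet F ∈ hereditarySets θ) {T : Set OmegaOne} (hT : IsStationary T) :
    ∃ β ∈ T, ∃ S : setLanguage.ElementarySubstructure (hereditarySets θ),
      (S : Set (hereditarySets θ)).Countable ∧ P ⊆ S ∧
      (∀ ξ, (⟨ordSet ξ, hord ξ⟩ : hereditarySets θ) ∈ S ↔ ξ < β) ∧
      ∀ F : Finset OmegaOne, (⟨finOrdSet F, hfin F⟩ : hereditarySets θ) ∈ S ↔ ↑F ⊆ Iio β := by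
  let H := hereditarySets θ
  let L' := setLanguage.sum setLanguage.skolem₁
  have : Nonempty H := ⟨⟨_, hfin ∅⟩⟩
  let o : OmegaOne → H := fun ξ => ⟨ordSet ξ, hord ξ⟩
  let e : Finset OmegaOne → H := fun F => ⟨finOrdSet F, hfin F⟩
  have ho : Function.Injective o := fun ξ η h => ordSet_injective (congrArg Subtype.val h)
  have he : Function.Injective e := fun ξ η h => finOrdSet_injective (congrArg Subtype.val h)
  let gen : OmegaOne → Set H := fun β => P ∪ (o '' Iio β ∪ e '' {F | ↑F ⊆ Iio β})
  let N : OmegaOne → L'.Substructure H := fun β => Substructure.closure L' (gen β)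
  have gen_mono : Monotone gen := fun β γ h => union_subset_union_right _ (union_subset_union
    (image_mono (Iio_subset_Iio h)) (image_mono fun F hF => hF.trans (Iio_subset_Iio h)))
  have N_mono : Monotone N := fun β γ h => (Substructure.closure L').monotone (gen_mono h)
  have N_countable : ∀ β, (N β : Set H).Countable := by
    intro β
    have : Countable (Σ l, L'.Functions l) := countable_skolem_functions
    have hg : (gen β).Countable := hP.union (((countable_Iio β).image o).union
      ((countable_finset_subset (countable_Iio β)).image e))
    exact hg.substructure_closure L'
  have bound : ∀ γ, ∃ δ, γ < δ ∧ (∀ ξ, o ξ ∈ N γ → ξ < δ) ∧ ∀ F, e F ∈ N γ → ↑F ⊆ Iio δ := by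
    intro γ
    have h1 : {ξ | o ξ ∈ N γ}.Countable := (N_countable γ).preimage_of_injOn ho.injOn
    have h2 : {F | e F ∈ N γ}.Countable := (N_countable γ).preimage_of_injOn he.injOn
    obtain ⟨δ, hδ⟩ := exists_forall_lt
      ((h1.union (h2.biUnion fun F _ => F.countable_toSet)).insert γ)
    exact ⟨δ, hδ γ (mem_insert _ _), fun ξ hξ => hδ ξ (mem_insert_of_mem _ (.inl hξ)),
      fun F hF ξ hξ => hδ ξ (mem_insert_of_mem _ (.inr (mem_biUnion hF hξ)))⟩
  choose g hg1 hg2 hg3 using bound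
  obtain ⟨β, hβT, hne, hcl⟩ := exists_mem_stationary_closed hT g
  -- Continuity: as `γ < g γ < β`, every generator of `N β` appears in an earlier hull.
  have N_lim : ∀ x, x ∈ N β → ∃ γ < β, x ∈ N γ := by
    have : Nonempty (Iio β) := Set.Nonempty.to_subtype hne
    have hle : N β ≤ ⨆ γ : Iio β, N γ := by
      refine Substructure.closure_le.2 ?_
      rintro x (hx | ⟨ξ, hξ, rfl⟩ | ⟨F, hF, rfl⟩)
      · obtain ⟨γ, hγ⟩ := hne
        exact le_iSup (fun γ : Iio β => N γ) ⟨γ, hγ⟩ (Substructure.subset_closure (.inl hx))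
      · refine le_iSup (fun γ : Iio β => N γ) ⟨g ξ, hcl ξ hξ⟩
          (Substructure.subset_closure (.inr (.inl ⟨ξ, hg1 ξ, rfl⟩)))
      · obtain ⟨γ, hγ, hFγ⟩ := finset_subset_Iic_of_closed hne hF
        refine le_iSup (fun γ : Iio β => N γ) ⟨g γ, hcl γ hγ⟩
          (Substructure.subset_closure (.inr (.inr ⟨F, fun ξ hξ => ?_, rfl⟩)))
        exact (mem_Iic.1 (hFγ hξ)).trans_lt (hg1 γ)
    intro x hx
    have hdir : Directed (· ≤ ·) fun γ : Iio β => N γ :=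
      (N_mono.comp (Subtype.mono_coe _)).directed_le
    obtain ⟨γ, hγ⟩ := (Substructure.mem_iSup_of_directed hdir).1 (hle hx)
    exact ⟨γ, γ.2, hγ⟩
  refine ⟨β, hβT, (N β).elementarySkolem₁Reduct, N_countable β,
    fun x hx => Substructure.subset_closure (.inl hx), fun ξ => ⟨fun h => ?_, fun h => ?_⟩,
    fun F => ⟨fun h => ?_, fun h => ?_⟩⟩
  · obtain ⟨γ, hγ, hx⟩ := N_lim _ h
    exact (hg2 γ ξ hx).trans (hcl γ hγ)
  · exact Substructure.subset_closure (.inr (.inl ⟨ξ, h, rfl⟩))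
  · obtain ⟨γ, hγ, hx⟩ := N_lim _ h
    exact (hg3 γ F hx).trans (Iio_subset_Iio (hcl γ hγ).le)
  · exact Substructure.subset_closure (.inr (.inr ⟨F, h, rfl⟩))

/-! ### Covers of the constructed space -/

namespace IsConstruction

variable {C : OmegaOne → Set OmegaOne} {B : OmegaOne → Set (Finset OmegaOne)}
  {U : OmegaOne → OmegaOne → Set OmegaOne} {φ : OmegaOne → OmegaOne → Finset ℝ}

theorem mem_limitSet_iff (h : IsConstruction C B U φ) {α γ ξ : OmegaOne} (hγ : γ ≤ α)
    (hξ : ξ ≤ α) : ξ ∈ limitSet U γ ↔ ξ ∈ U α γ := by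
  refine ⟨fun hx => ?_, fun hx => mem_biUnion (x := α) hγ hx⟩
  obtain ⟨δ, hδ, hx⟩ := mem_iUnion₂.1 hx
  rcases le_total α δ with hle | hle
  · rw [h.coherent α δ hle γ hγ]
    exact ⟨hx, hξ⟩
  · rw [h.coherent δ α hle γ hδ] at hx
    exact hx.1

theorem mem_limitSet_of_le (h : IsConstruction C B U φ) {γ ξ : OmegaOne} (hξ : ξ ≤ γ) :
    ξ ∈ limitSet U γ := by
  rw [h.mem_limitSet_iff le_rfl hξ, h.self]
  exact hξ

/-- The limit objects `limitMap φ` and `limitSet U` are put into the submodel; by coherence they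
restrict to the stage `β` data, as `guessSet` requires. -/
theorem exists_guessed (h : IsConstruction C B U φ) (hB : IsFinsetDiamondSequence B)
    {X : Set (Finset OmegaOne)} (hX : ¬ X.Countable) (hdisj : X.PairwiseDisjoint id) :
    ∃ β, {F | F ∈ X ∧ (F : Set OmegaOne) ⊆ Iio β} = B β ∧
      ∀ α, β ≤ α → β ∈ guessSet B U φ α := by
  let params : Set ZFSet.{0} := {ratBaseSet, graphSet ordSet (imageSet finOrdSet) B,
    graphSet ordSet finRealSet (limitMap φ), imageSet finOrdSet X,
    graphSet ordSet (imageSet ordSet) (limitSet U)}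
  have hparams : params.Finite := by simp [params]
  -- The last two entries serve only to place the codes of all points and all finite sets in `H(θ)`.
  obtain ⟨θ, hθ, hθx⟩ := exists_isSufficientlyLarge
    {ratBaseSet, graphSet ordSet (imageSet finOrdSet) B,
      graphSet ordSet finRealSet (limitMap φ), imageSet finOrdSet X,
      graphSet ordSet (imageSet ordSet) (limitSet U), imageSet ordSet univ,
      imageSet finOrdSet univ}
  have hmem := fun y hy => hereditarySets_trans (y := y) hθx hy
  have hord : ∀ ξ, ordSet ξ ∈ hereditarySets θ := fun ξ =>
    hereditarySets_trans (hmem (imageSet ordSet univ) (by simp)) (mem_imageSet.2 ⟨ξ, trivial, rfl⟩)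
  have hfin : ∀ F, finOrdSet F ∈ hereditarySets θ := fun F =>
    hereditarySets_trans (hmem (imageSet finOrdSet univ) (by simp))
      (mem_imageSet.2 ⟨F, trivial, rfl⟩)
  obtain ⟨β, hβ, S, hS, hPS, hSo, hSf⟩ := exists_submodel_of_stationary
    (Subtype.val ⁻¹' params : Set (hereditarySets θ))
    (hparams.countable.preimage_of_injOn Subtype.val_injective.injOn) hord hfin (hB X hX)
  have hpS : ∀ y ∈ params, y ∈ Subtype.val '' (S : Set (hereditarySets θ)) := by
    intro y hy
    refine ⟨⟨y, hmem y ?_⟩, hPS hy, rfl⟩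
    simp only [params, mem_insert_iff, mem_singleton_iff] at hy
    simp only [ZFSet.mem_insert_iff, ZFSet.mem_singleton]
    tauto
  have hso : ∀ ξ, ordSet ξ ∈ Subtype.val '' (S : Set (hereditarySets θ)) ↔ ξ < β := fun ξ => by
    rw [← hSo ξ]
    simp [hord ξ]
  have hsf : ∀ F : Finset OmegaOne, finOrdSet F ∈ Subtype.val '' (S : Set (hereditarySets θ)) ↔
      ↑F ⊆ Iio β := fun F => by
    rw [← hSf F]
    simp [hfin F]
  refine ⟨β, hβ, fun α hα => ⟨hα, fun F hF => ?_, ?_, θ, _, hθ, ⟨hS.image _, S, rfl⟩, ?_,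
    hpS _ (by simp [params]), hpS _ (by simp [params]),
    ⟨limitMap φ, hpS _ (by simp [params]), fun ξ hξ => h.coherent_map ξ β hξ.le ξ le_rfl⟩,
    ⟨X, hX, hpS _ (by simp [params]), ?_⟩,
    ⟨limitSet U, hpS _ (by simp [params]), fun γ hγ => ?_⟩⟩⟩
  · exact (Set.ext_iff.1 hβ F).2 hF |>.2
  · rw [← hβ]
    exact hdisj.subset fun F hF => hF.1
  · exact Set.ext hso
  · rw [← hβ]
    ext F
    exact and_congr_right fun _ => hsf F
  · ext ξ
    exact and_congr_left fun hξ => h.mem_limitSet_iff hγ.le (le_of_lt hξ)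

/-- Every uncountable pairwise disjoint family of finite sets has a countable subfamily whose
sets `U_F` cover the space and form an `ω`-cover of a tail. -/
theorem exists_countable_cover (h : IsConstruction C B U φ) (hB : IsFinsetDiamondSequence B)
    {X : Set (Finset OmegaOne)} (hX : ¬ X.Countable) (hdisj : X.PairwiseDisjoint id) :
    ∃ X' ⊆ X, X'.Countable ∧ (⋃ F ∈ X', limitInter U F) = univ ∧
      ∃ β : OmegaOne, IsOmegaCover {V | ∃ F ∈ X', V = limitInter U F} (Ioi β) := by
  obtain ⟨β, hβ, hguess⟩ := h.exists_guessed hB hX hdisj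
  have hBX : B β ⊆ X := fun F hF => ((Set.ext_iff.1 hβ F).2 hF).1
  have hBβ : ∀ F ∈ B β, ↑F ⊆ Iio β := fun F hF => ((Set.ext_iff.1 hβ F).2 hF).2
  have key : ∀ ξ : OmegaOne, ∃ F ∈ X, ξ ∈ limitInter U F := by
    intro ξ
    by_contra! hcon
    refine hX ?_
    -- If no `U_F` contained `ξ`, each `F` would have a point below `ξ`. By disjointness these
    -- points differ, so the family would inject into a countable set.
    have hmeet : ∀ F ∈ X, ∃ γ ∈ F, γ < ξ := by
      intro F hF
      by_contra! hle
      exact hcon F hF (mem_iInter₂.2 fun γ hγ => h.mem_limitSet_of_le (hle γ hγ))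
    have : Nonempty OmegaOne := ⟨ξ⟩
    choose! p hp hpξ using hmeet
    refine MapsTo.countable_of_injOn (f := p) (t := Iio ξ) (fun F hF => hpξ F hF) ?_
      (countable_Iio ξ)
    intro F hF G hG heq
    by_contra hne
    exact Finset.disjoint_left.1 (hdisj hF hG hne) (hp F hF) (heq ▸ hp G hG)
  choose F hFX hF using key
  have hcov : IsOmegaCover {V | ∃ E ∈ B β ∪ F '' Iic β, V = limitInter U E} (Ioi β) := by
    intro K hK hKβ
    obtain ⟨α, hα⟩ := exists_forall_lt (hK.countable.insert β)
    have hβα : β < α := hα β (mem_insert _ _)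
    obtain ⟨_, ⟨E, hE, -, rfl⟩, hKE⟩ := h.omega_cover α ⟨β, hβα.le⟩ (hguess α hβα.le) hβα univ
      (@isOpen_univ _ (_)) trivial K hK fun ξ hξ => ⟨hKβ hξ, (hα ξ (mem_insert_of_mem _ hξ)).le⟩
    refine ⟨_, ⟨E, .inl hE, rfl⟩, fun ξ hξ => mem_iInter₂.2 fun γ hγ => ?_⟩
    have := hKE hξ
    exact (h.mem_limitSet_iff ((hBβ E hE hγ).trans hβα).le this.1).2 (this.2 γ hγ)
  refine ⟨B β ∪ F '' Iic β, union_subset hBX (image_subset_iff.2 fun ξ _ => hFX ξ),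
    .union ?_ ((countable_Iic β).image F), eq_univ_of_forall fun ξ => ?_, β, hcov⟩
  · exact (countable_finset_subset (countable_Iio β)).mono hBβ
  · rcases le_or_gt ξ β with hξ | hξ
    · exact mem_biUnion (.inr ⟨ξ, hξ, rfl⟩) (hF ξ)
    · obtain ⟨_, ⟨E, hE, rfl⟩, hs⟩ := hcov {ξ} (finite_singleton ξ) (by simpa using hξ)
      exact mem_biUnion hE (hs rfl)

end IsConstruction

end

/-! ### Finite powers are hereditarily Lindelöf -/

theorem exists_countable_subset_image {α β : Type*} {f : α → β} {s : Set α} {t : Set β}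
    (ht : t ⊆ f '' s) (hc : t.Countable) : ∃ s' ⊆ s, s'.Countable ∧ t ⊆ f '' s' := by
  choose g hg hfg using ht
  have := hc.to_subtype
  refine ⟨range fun b : t => g b.2, ?_, countable_range _, fun b hb => ?_⟩
  · rintro _ ⟨b, rfl⟩
    exact hg b.2
  · exact ⟨_, ⟨⟨b, hb⟩, rfl⟩, hfg hb⟩

/-- A family of sets `N a`, `a ∈ 𝒢`, has a countable subfamily with the same union if its union is
the union of countably many sets that are covered by countable subfamilies. -/
theorem exists_countable_subfamily_of_iUnion {α X ι : Type*} [Countable ι] {N : α → Set X}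
    {𝒢 : Set α} {A : ι → Set X}
    (h : ∀ i, ∃ 𝒢' ⊆ 𝒢, 𝒢'.Countable ∧ A i ⊆ ⋃ a ∈ 𝒢', N a) (hA : ⋃ a ∈ 𝒢, N a ⊆ ⋃ i, A i) :
    ∃ 𝒢' ⊆ 𝒢, 𝒢'.Countable ∧ ⋃ a ∈ 𝒢, N a ⊆ ⋃ a ∈ 𝒢', N a := by
  choose 𝒟 h1 h2 h3 using h
  refine ⟨⋃ i, 𝒟 i, iUnion_subset h1, countable_iUnion h2, hA.trans (iUnion_subset fun i => ?_)⟩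
  exact (h3 i).trans (biUnion_subset_biUnion_left (subset_iUnion 𝒟 i))

theorem exists_maximal_pairwiseDisjoint {α β : Type*} (s : α → Finset β) (𝒢 : Set α) :
    ∃ 𝒟 ⊆ 𝒢, 𝒟.PairwiseDisjoint s ∧ ∀ a ∈ 𝒢, a ∉ 𝒟 → ∃ b ∈ 𝒟, ¬ Disjoint (s a) (s b) := by
  obtain ⟨𝒟, h𝒟⟩ := zorn_subset {𝒟 | 𝒟 ⊆ 𝒢 ∧ 𝒟.PairwiseDisjoint s} (fun c hc hch =>
    ⟨⋃₀ c, ⟨sUnion_subset fun t ht => (hc ht).1,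
      (pairwiseDisjoint_sUnion hch.directedOn).2 fun t ht => (hc ht).2⟩,
      fun t ht => subset_sUnion_of_mem ht⟩)
  refine ⟨𝒟, h𝒟.prop.1, h𝒟.prop.2, fun a ha haD => ?_⟩
  by_contra! hcon
  have : insert a 𝒟 ⊆ 𝒟 := h𝒟.le_of_ge ⟨insert_subset ha h𝒟.prop.1,
    h𝒟.prop.2.insert fun b hb _ => hcon b hb⟩ (subset_insert _ _)
  exact haD (this (mem_insert _ _))

/-- The product of the sets `⋂ γ ∈ G i, V γ`. -/
def interProd (V : OmegaOne → Set OmegaOne) {n : ℕ} (G : Fin n → Finset OmegaOne) :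
    Set (Fin n → OmegaOne) :=
  {x | ∀ i, ∀ γ ∈ G i, x i ∈ V γ}

/-- Induction on the number of factors and, inside it, on the total size `m` of the index sets. A
maximal disjoint subfamily decides the case: if it is countable, one index can be removed; if
uncountable, `hV` leaves only points with a coordinate in a countable set, which can be fixed. -/
theorem exists_countable_subfamily_interProd {V : OmegaOne → Set OmegaOne}
    (hV : ∀ X : Set (Finset OmegaOne), ¬ X.Countable → X.PairwiseDisjoint id →
      ∃ X' ⊆ X, X'.Countable ∧ ∃ β : OmegaOne,
        ∀ K : Set OmegaOne, K.Finite → K ⊆ Ioi β → ∃ F ∈ X', ∀ γ ∈ F, K ⊆ V γ) (n : ℕ)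
    (𝒢 : Set (Fin n → Finset OmegaOne)) :
    ∃ 𝒢' ⊆ 𝒢, 𝒢'.Countable ∧ ⋃ G ∈ 𝒢, interProd V G ⊆ ⋃ G ∈ 𝒢', interProd V G := by
  classical
  induction n with
  | zero =>
    refine ⟨𝒢, Subset.rfl, (Subsingleton.finite fun _ _ _ _ => Subsingleton.elim _ _).countable,
      Subset.rfl⟩
  | succ n ihn =>
    have main : ∀ m : ℕ, ∀ 𝒢 : Set (Fin (n + 1) → Finset OmegaOne),
        (∀ G ∈ 𝒢, ∑ i, (G i).card = m) →
        ∃ 𝒢' ⊆ 𝒢, 𝒢'.Countable ∧ ⋃ G ∈ 𝒢, interProd V G ⊆ ⋃ G ∈ 𝒢', interProd V G := by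
      intro m
      induction m using Nat.strong_induction_on with
      | _ m ihm =>
      intro 𝒢 h𝒢
      let s : (Fin (n + 1) → Finset OmegaOne) → Finset OmegaOne := fun G => Finset.univ.biUnion G
      have mem_s : ∀ {G i γ}, γ ∈ G i → γ ∈ s G := fun {G i γ} h =>
        Finset.mem_biUnion.2 ⟨i, Finset.mem_univ _, h⟩
      obtain ⟨𝒟, h𝒟, hdisj, hmax⟩ := exists_maximal_pairwiseDisjoint s 𝒢
      by_cases hc : 𝒟.Countable
      · have hD : (⋃ G ∈ 𝒟, (s G : Set OmegaOne)).Countable :=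
          hc.biUnion fun G _ => (s G).countable_toSet
        have := hD.to_subtype
        -- By maximality each remaining `G` has one of countably many `d` in one of its components.
        -- Erasing `d` there lowers `m`, and it can be restored afterwards, since the points to be
        -- covered already satisfy the condition for `d`.
        let A : Option (↥(⋃ G ∈ 𝒟, (s G : Set OmegaOne)) × Fin (n + 1)) →
          Set (Fin (n + 1) → OmegaOne) := fun o => o.elim (⋃ G ∈ 𝒟, interProd V G)
            fun q => ⋃ G ∈ {G ∈ 𝒢 | (q.1 : OmegaOne) ∈ G q.2}, interProd V G
        refine exists_countable_subfamily_of_iUnion (A := A) ?_ ?_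
        · rintro (_ | ⟨⟨d, hd⟩, i⟩)
          · exact ⟨𝒟, h𝒟, hc, Subset.rfl⟩
          · let r : (Fin (n + 1) → Finset OmegaOne) → (Fin (n + 1) → Finset OmegaOne) :=
              fun G => Function.update G i ((G i).erase d)
            have hr : ∀ G, interProd V G ⊆ interProd V (r G) := by
              intro G x hx j γ hγ
              refine hx j γ ?_
              rcases eq_or_ne j i with rfl | hne
              · rw [show r G j = (G j).erase d from Function.update_self ..] at hγ
                exact Finset.mem_of_mem_erase hγ
              · rwa [show r G j = G j from Function.update_of_ne hne ..] at hγ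
            rcases ({G ∈ 𝒢 | d ∈ G i}).eq_empty_or_nonempty with hemp | ⟨G₀, hG₀, hdG₀⟩
            · refine ⟨∅, empty_subset _, countable_empty, fun x hx => ?_⟩
              obtain ⟨G, hG, -⟩ := mem_iUnion₂.1 hx
              exact absurd hG (eq_empty_iff_forall_notMem.1 hemp G)
            have hcard : ∀ G ∈ 𝒢, d ∈ G i → ∑ j, (r G j).card = m - 1 := by
              intro G hG hdG
              have h1 := h𝒢 G hG
              rw [← Finset.add_sum_erase _ _ (Finset.mem_univ i)] at h1 ⊢
              rw [show r G i = (G i).erase d from Function.update_self ..,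
                Finset.card_erase_of_mem hdG,
                Finset.sum_congr rfl fun j hj => by
                  rw [show r G j = G j from Function.update_of_ne (Finset.ne_of_mem_erase hj) ..]]
              have := Finset.card_pos.2 ⟨d, hdG⟩
              omega
            have hm : m - 1 < m := by
              have h1 := h𝒢 G₀ hG₀
              have := Finset.card_pos.2 ⟨d, hdG₀⟩
              rw [← Finset.add_sum_erase _ _ (Finset.mem_univ i)] at h1
              omega
            obtain ⟨𝒞, h𝒞, h𝒞c, hcov⟩ := ihm (m - 1) hm (r '' {G ∈ 𝒢 | d ∈ G i}) (by
              rintro _ ⟨G, ⟨hG, hdG⟩, rfl⟩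
              exact hcard G hG hdG)
            obtain ⟨𝒢', h1, h2, h3⟩ := exists_countable_subset_image h𝒞 h𝒞c
            refine ⟨𝒢', h1.trans (sep_subset _ _), h2, ?_⟩
            intro x hx
            obtain ⟨G, hG, hxG⟩ := mem_iUnion₂.1 hx
            obtain ⟨E, hE, hxE⟩ := mem_iUnion₂.1 (hcov (mem_biUnion ⟨G, hG, rfl⟩ (hr G hxG)))
            obtain ⟨G', hG', rfl⟩ := h3 hE
            refine mem_biUnion hG' fun j γ hγ => ?_
            by_cases hji : j = i ∧ γ = d
            · obtain ⟨rfl, rfl⟩ := hji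
              exact hxG j γ hG.2
            · refine hxE j γ ?_
              rcases eq_or_ne j i with rfl | hne
              · rw [show r G' j = (G' j).erase d from Function.update_self ..]
                exact Finset.mem_erase.2 ⟨fun h => hji ⟨rfl, h⟩, hγ⟩
              · rwa [show r G' j = G' j from Function.update_of_ne hne ..]
        · intro x hx
          obtain ⟨G, hG, hxG⟩ := mem_iUnion₂.1 hx
          by_cases hGD : G ∈ 𝒟
          · exact mem_iUnion.2 ⟨none, mem_biUnion hGD hxG⟩
          · obtain ⟨E, hE, hnd⟩ := hmax G hG hGD
            obtain ⟨d, hd, hd'⟩ := Finset.not_disjoint_iff.1 hnd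
            obtain ⟨i, -, hi⟩ := Finset.mem_biUnion.1 hd
            exact mem_iUnion.2 ⟨some (⟨d, mem_biUnion hE hd'⟩, i),
              mem_biUnion (x := G) ⟨hG, hi⟩ hxG⟩
      · have hinj : InjOn s 𝒟 := by
          intro G hG E hE heq
          by_contra hne
          have h1 : Disjoint (s G) (s E) := hdisj hG hE hne
          have h2 : s E = ∅ := by
            rw [heq] at h1
            exact disjoint_self.1 h1
          have h3 : ∀ {F}, s F = ∅ → ∀ i, F i = ∅ := fun {F} hF i =>
            Finset.eq_empty_of_forall_notMem fun γ hγ => by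
              have := mem_s hγ
              simp [hF] at this
          exact hne (funext fun i => by rw [h3 (heq.trans h2) i, h3 h2 i])
        obtain ⟨X', hX', hX'c, β, hβ⟩ := hV (s '' 𝒟)
          (fun h => hc (countable_of_injective_of_countable_image hinj h))
          (by
            rintro _ ⟨G, hG, rfl⟩ _ ⟨E, hE, rfl⟩ hne
            exact hdisj hG hE fun h => hne (h ▸ rfl))
        obtain ⟨𝒟', h1, h2, h3⟩ := exists_countable_subset_image hX' hX'c
        have := (countable_Iic β).to_subtype
        -- Points with all coordinates above `β` are covered through `hV`. The others have a
        -- coordinate `i` equal to some `ξ ≤ β`; dropping it leaves `n` factors and those `G` whose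
        -- `i`-th condition holds at `ξ`.
        let A : Option (Iic β × Fin (n + 1)) → Set (Fin (n + 1) → OmegaOne) := fun o =>
          o.elim {x | ∀ i, β < x i}
            fun q => {x | x q.2 = q.1 ∧ x ∈ ⋃ G ∈ 𝒢, interProd V G}
        refine exists_countable_subfamily_of_iUnion (A := A) ?_ ?_
        · rintro (_ | ⟨⟨ξ, hξ⟩, i⟩)
          · refine ⟨𝒟', h1.trans h𝒟, h2, fun x hx => ?_⟩
            obtain ⟨F, hF, hFx⟩ := hβ (range x) (finite_range x) (range_subset_iff.2 hx)
            obtain ⟨G, hG, rfl⟩ := h3 hF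
            exact mem_biUnion hG fun i γ hγ => hFx γ (mem_s hγ) (mem_range_self i)
          · let r : (Fin (n + 1) → Finset OmegaOne) → (Fin n → Finset OmegaOne) :=
              fun G j => G (i.succAbove j)
            obtain ⟨𝒞, h𝒞, h𝒞c, hcov⟩ := ihn (r '' {G ∈ 𝒢 | ∀ γ ∈ G i, ξ ∈ V γ})
            obtain ⟨𝒢', h1, h2, h3⟩ := exists_countable_subset_image h𝒞 h𝒞c
            refine ⟨𝒢', h1.trans (sep_subset _ _), h2, ?_⟩
            rintro x ⟨hxi, hx⟩
            have hxi : x i = ξ := hxi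
            obtain ⟨G, hG, hxG⟩ := mem_iUnion₂.1 hx
            obtain ⟨E, hE, hxE⟩ := mem_iUnion₂.1 (hcov (a := fun j => x (i.succAbove j))
              (mem_biUnion ⟨G, ⟨hG, fun γ hγ => hxi ▸ hxG i γ hγ⟩, rfl⟩ fun j γ hγ => hxG _ γ hγ))
            obtain ⟨G', hG', rfl⟩ := h3 hE
            refine mem_biUnion hG' fun j => ?_
            rcases Fin.eq_self_or_eq_succAbove i j with rfl | ⟨k, rfl⟩
            · exact hxi.symm ▸ (h1 hG').2
            · exact hxE k
        · intro x hx
          by_cases hxβ : ∀ i, β < x i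
          · exact mem_iUnion.2 ⟨none, hxβ⟩
          · push Not at hxβ
            obtain ⟨i, hi⟩ := hxβ
            exact mem_iUnion.2 ⟨some (⟨x i, hi⟩, i), rfl, hx⟩
    refine exists_countable_subfamily_of_iUnion (ι := ℕ)
      (A := fun m => ⋃ G ∈ {G ∈ 𝒢 | ∑ i, (G i).card = m}, interProd V G) (fun m => ?_) ?_
    · obtain ⟨𝒢', h1, h2, h3⟩ := main m {G ∈ 𝒢 | ∑ i, (G i).card = m} fun G hG => hG.2
      exact ⟨𝒢', h1.trans (sep_subset _ _), h2, h3⟩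
    · intro x hx
      obtain ⟨G, hG, hxG⟩ := mem_iUnion₂.1 hx
      exact mem_iUnion.2 ⟨_, mem_biUnion (x := G) ⟨hG, rfl⟩ hxG⟩

namespace IsConstruction

variable {C : OmegaOne → Set OmegaOne} {B : OmegaOne → Set (Finset OmegaOne)}
  {U : OmegaOne → OmegaOne → Set OmegaOne} {φ : OmegaOne → OmegaOne → Finset ℝ}

theorem exists_limit_nbhd_subset {O : Set OmegaOne} (hO : IsOpen[limitTopology U φ] O)
    {x : OmegaOne} (hx : x ∈ O) :
    ∃ (G : Finset OmegaOne) (𝒮 : Finset (Set (Finset ℝ))), ↑𝒮 ⊆ ratBase ∧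
      x ∈ nbhd (limitSet U) (limitMap φ) G 𝒮 ∧ nbhd (limitSet U) (limitMap φ) G 𝒮 ⊆ O := by
  refine exists_nbhd_subset_of_generateFrom id ?_ hO hx
  rintro _ (⟨γ, rfl⟩ | ⟨W, hW, rfl⟩) x hx
  · exact ⟨{γ}, ∅, by simp, ⟨by simpa using hx, by simp⟩,
      fun y hy => hy.1 γ (Finset.mem_singleton_self γ)⟩
  · exact ⟨∅, {W}, by simpa using hW, ⟨by simp, by simpa using hx⟩,
      fun y hy => hy.2 W (Finset.mem_singleton_self W)⟩

/-- The finite powers of the constructed space are hereditarily Lindelöf, stated for covers by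
powers of open sets. -/
theorem exists_countable_subfamily_pow (h : IsConstruction C B U φ)
    (hB : IsFinsetDiamondSequence B) (n : ℕ) (𝒱 : Set (Set OmegaOne))
    (h𝒱 : ∀ O ∈ 𝒱, IsOpen[limitTopology U φ] O) :
    ∃ 𝒱' ⊆ 𝒱, 𝒱'.Countable ∧ ∀ x : Fin n → OmegaOne, (∃ O ∈ 𝒱, ∀ i, x i ∈ O) →
      ∃ O ∈ 𝒱', ∀ i, x i ∈ O := by
  have hpow := exists_countable_subfamily_interProd (V := limitSet U) (fun X hX hdisj => by
    obtain ⟨X', h1, h2, -, β, h3⟩ := h.exists_countable_cover hB hX hdisj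
    refine ⟨X', h1, h2, β, fun K hK hKβ => ?_⟩
    obtain ⟨_, ⟨F, hF, rfl⟩, hKF⟩ := h3 K hK hKβ
    exact ⟨F, hF, fun γ hγ x hx => mem_iInter₂.1 (hKF hx) γ hγ⟩) n
  have : Countable {𝒮 : Finset (Set (Finset ℝ)) // ↑𝒮 ⊆ ratBase} := by
    refine ((countable_ofPred_finite_subset countable_ratBase).preimage_of_injOn
      (f := fun 𝒮 : Finset (Set (Finset ℝ)) => (𝒮 : Set (Set (Finset ℝ))))
      Finset.coe_injective.injOn).mono (s₁ := {𝒮 | ↑𝒮 ⊆ ratBase}) fun 𝒮 h𝒮 => ?_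
    exact ⟨𝒮.finite_toSet, h𝒮⟩
  -- Fixing the part of the basic neighbourhoods that concerns `φ`, for which there are countably
  -- many choices, leaves only products of sets `U_F`.
  let 𝒢 : (Fin n → {𝒮 : Finset (Set (Finset ℝ)) // ↑𝒮 ⊆ ratBase}) →
      Set (Fin n → Finset OmegaOne) := fun 𝒮 =>
    {G | ∃ O ∈ 𝒱, ∀ i, nbhd (limitSet U) (limitMap φ) (G i) (𝒮 i) ⊆ O}
  choose 𝒢' h1 h2 h3 using fun 𝒮 => hpow (𝒢 𝒮)
  choose O hO𝒱 hO using fun 𝒮 (G : 𝒢' 𝒮) => h1 𝒮 G.2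
  refine ⟨⋃ 𝒮, range (O 𝒮), iUnion_subset fun 𝒮 => range_subset_iff.2 (hO𝒱 𝒮), ?_, ?_⟩
  · refine countable_iUnion fun 𝒮 => ?_
    have := (h2 𝒮).to_subtype
    exact countable_range _
  · rintro x ⟨Q, hQ, hxQ⟩
    choose G 𝒮 h𝒮 hxn hn using fun i => exists_limit_nbhd_subset (h𝒱 Q hQ) (hxQ i)
    let 𝒮' : Fin n → {𝒮 : Finset (Set (Finset ℝ)) // ↑𝒮 ⊆ ratBase} := fun i => ⟨𝒮 i, h𝒮 i⟩
    obtain ⟨E, hE, hxE⟩ := mem_iUnion₂.1 (h3 𝒮' (mem_biUnion (x := G) ⟨Q, hQ, hn⟩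
      fun i γ hγ => (hxn i).1 γ hγ))
    exact ⟨_, mem_iUnion.2 ⟨𝒮', ⟨E, hE⟩, rfl⟩,
      fun i => hO 𝒮' ⟨E, hE⟩ i ⟨hxE i, (hxn i).2⟩⟩

/-! ### Hereditary Lindelöfness and the hereditary (ε)-property -/

theorem hereditarilyLindelofSpace (h : IsConstruction C B U φ) (hB : IsFinsetDiamondSequence B) :
    @HereditarilyLindelofSpace OmegaOne (limitTopology U φ) := by
  let _ : TopologicalSpace OmegaOne := limitTopology U φ
  refine ⟨fun Y _ => isLindelof_of_countable_subcover fun {ι} O hO hY => ?_⟩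
  obtain ⟨𝒱', h1, h2, h3⟩ := h.exists_countable_subfamily_pow hB 1 (range O)
    (by rintro _ ⟨i, rfl⟩; exact hO i)
  rw [← image_univ] at h1
  obtain ⟨t, -, ht, ht'⟩ := exists_countable_subset_image h1 h2
  refine ⟨t, ht, fun x hx => ?_⟩
  obtain ⟨i, hi⟩ := mem_iUnion.1 (hY hx)
  obtain ⟨Q, hQ, hxQ⟩ := h3 (fun _ => x) ⟨O i, mem_range_self i, fun _ => hi⟩
  obtain ⟨j, hj, rfl⟩ := ht' hQ
  exact mem_biUnion hj (hxQ 0)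

/-- A finite set listed as an `n`-tuple lies in `O` exactly when the tuple lies in the `n`-th power
of `O`, so the union over `n` of the countable subfamilies for powers is an `ω`-cover. -/
theorem isHereditarilyEpsilonSpace (h : IsConstruction C B U φ)
    (hB : IsFinsetDiamondSequence B) :
    @IsHereditarilyEpsilonSpace OmegaOne (limitTopology U φ) := by
  let _ : TopologicalSpace OmegaOne := limitTopology U φ
  intro Y 𝒰 h𝒰 hcov
  choose 𝒱 h1 h2 h3 using fun n => h.exists_countable_subfamily_pow hB n
    {O | IsOpen O ∧ (Subtype.val ⁻¹' O : Set Y) ∈ 𝒰} fun O hO => hO.1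
  refine ⟨⋃ n, (fun O => (Subtype.val ⁻¹' O : Set Y)) '' 𝒱 n, ?_,
    countable_iUnion fun n => (h2 n).image _, ?_⟩
  · refine iUnion_subset fun n => image_subset_iff.2 fun O hO => (h1 n hO).2
  · intro K hK _
    obtain ⟨Q, hQ, hKQ⟩ := hcov K hK (subset_univ _)
    obtain ⟨O, hO, rfl⟩ := isOpen_induced_iff.1 (h𝒰 Q hQ)
    obtain ⟨n, x, -, hx⟩ := hK.fin_param
    obtain ⟨O', hO', hxO'⟩ := h3 n (fun i => x i) ⟨O, ⟨hO, hQ⟩, fun i => hKQ (hx ▸ mem_range_self i)⟩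
    refine ⟨_, mem_iUnion.2 ⟨n, O', hO', rfl⟩, fun y hy => ?_⟩
    rw [← hx] at hy
    obtain ⟨i, rfl⟩ := hy
    exact hxO' i

end IsConstruction

end

theorem mainTheorem4 (hDiamond : Diamond) :
    (∃ C : OmegaOne → Set OmegaOne, IsCountableSetEnumeration C) ∧
    (∃ B : OmegaOne → Set (Finset OmegaOne), IsFinsetDiamondSequence B) ∧
    ∀ (C : OmegaOne → Set OmegaOne) (B : OmegaOne → Set (Finset OmegaOne)),
      IsCountableSetEnumeration C → IsFinsetDiamondSequence B →
      (∃ (U : OmegaOne → OmegaOne → Set OmegaOne) (φ : OmegaOne → OmegaOne → Finset ℝ),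
        IsConstruction C B U φ ∧ ∀ α, ∀ ξ ≤ α, (φ α ξ).Nonempty) ∧
      ∀ (U : OmegaOne → OmegaOne → Set OmegaOne) (φ : OmegaOne → OmegaOne → Finset ℝ),
        IsConstruction C B U φ →
        (∀ S : Set (Finset OmegaOne), ¬ S.Countable → S.PairwiseDisjoint id →
          ∃ S' ⊆ S, S'.Countable ∧
            (⋃ F ∈ S', limitInter U F) = univ ∧
            ∃ β : OmegaOne, IsOmegaCover {V | ∃ F ∈ S', V = limitInter U F} (Ioi β)) ∧
        @HereditarilyLindelofSpace OmegaOne (limitTopology U φ) ∧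
        @IsHereditarilyEpsilonSpace OmegaOne (limitTopology U φ) :=
  ⟨exists_isCountableSetEnumeration hDiamond, exists_isFinsetDiamondSequence hDiamond,
    fun _ B hC hB => ⟨exists_isConstruction B hC, fun _ _ h =>
      ⟨fun _ hS hdisj => h.exists_countable_cover hB hS hdisj, h.hereditarilyLindelofSpace hB,
        h.isHereditarilyEpsilonSpace hB⟩⟩⟩
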